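/- Let $H_3$ be the friendship graph consisting of three triangles that share exactly one common vertex, and let $ex_{\mathcal P}(n,H_3)$ be the maximum number of edges of a planar graph on $n$ vertices that does not contain $H_3$ as a (not necessarily induced) subgraph. All graphs are finite and simple. Then for every integer $n\ge 13$, $$ex_{\mathcal P}(n,H_3)\le \frac{67n}{24}-4,$$ with equality if and only if $24$ divides $n$. Moreover, let $G$ be an $H_3$-free plane graph on $n\ge 13$ vertices. A triangular-block of $G$ is a subgraph obtained by starting with the edges of a $3$-face of $G$ and, as long as possible, adding the edges of a $3$-face of $G$ that contains an edge already present. Let $R_6$ be the graph of the icosahedron. Then $G$ has exactly $\frac{67n}{24}-4$ edges if and only if all of the following hold: $G$ is connected; every face of $G$ is a $3$-face or a $4$-face; every triangular-block of $G$ is isomorphic to $R_6$ and contains exactly $19$ of the $3$-faces of $G$; every vertex of $G$ belongs to exactly one triangular-block. -/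

import Mathlib

open SimpleGraph

namespace PlanarTuran

/-- The friendship graph `H_k`: `k` triangles sharing one common vertex `none`; the other two
vertices of the `i`-th triangle are `some (i, false)` and `some (i, true)`. -/
def friendshipGraph (k : ℕ) : SimpleGraph (Option (Fin k × Bool)) where
  Adj x y := x ≠ y ∧ ∀ p q, x = some p → y = some q → p.1 = q.1
  symm := ⟨fun _ _ h => ⟨h.1.symm, fun p q hp hq => (h.2 q p hq hp).symm⟩⟩
  loopless := ⟨fun _ h => h.1 rfl⟩

/-- The icosahedron graph: a pentagonal antiprism with a pole on each side. The poles are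
`(false, none)` and `(true, none)`; `(b, some i)`, for `i` modulo `5`, are the vertices of the
pentagon around the pole `(b, none)`. The vertex `(true, some i)` is joined to `(false, some i)` and
`(false, some (i + 1))`. -/
def icosahedron : SimpleGraph (Bool × Option (ZMod 5)) :=
  SimpleGraph.fromRel fun x y =>
    (x.1 = y.1 ∧ x.2 = none) ∨
    (∃ i : ZMod 5, x = (true, some i) ∧ y = (true, some (i + 1))) ∨
    (∃ i : ZMod 5, x = (false, some i) ∧ y = (false, some (i + 1))) ∨
    (∃ i : ZMod 5, x = (true, some i) ∧ (y = (false, some i) ∨ y = (false, some (i + 1))))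

variable {V : Type*}

/-- A rotation system (combinatorial embedding into an oriented surface) of a graph: at every
vertex a cyclic order of the darts (oriented edges) leaving it, given by the permutation `next` whose
cycles are exactly the sets of darts with the same initial vertex. -/
structure RotationSystem (G : SimpleGraph V) where
  next : Equiv.Perm G.Dart
  sameCycle_iff : ∀ d d' : G.Dart, next.SameCycle d d' ↔ d.fst = d'.fst

namespace RotationSystem

variable {G : SimpleGraph V} (M : RotationSystem G)

/-- Reversal of darts. -/
def rev (G : SimpleGraph V) : Equiv.Perm G.Dart :=
  ⟨Dart.symm, Dart.symm, Dart.symm_symm, Dart.symm_symm⟩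

/-- The face permutation: from a dart `u → v` the boundary walk of the face continues with the
dart that comes next after `v → u` in the rotation at `v`. -/
def facePerm : Equiv.Perm G.Dart := (rev G).trans M.next

/-- The faces having at least one edge on their boundary: the cycles of the face permutation. -/
def Face : Type _ := Quotient (Equiv.Perm.SameCycle.setoid M.facePerm)

/-- The face whose boundary walk runs through the dart `d`. -/
def face (d : G.Dart) : M.Face := Quotient.mk (Equiv.Perm.SameCycle.setoid M.facePerm) d

/-- The size of a face: the length of its boundary walk (an edge with the face on both
sides counts twice). -/
noncomputable def size (f : M.Face) : ℕ := {d : G.Dart | M.face d = f}.ncard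

/-- The rotation system has genus `0`, that is, it is an embedding into the sphere (equivalently
the plane), one sphere for each connected component. Every component satisfies
`v - e + f = 2 - 2 * genus ≤ 2`, so that all components are spherical if and only if the sum
of the left sides is twice the number of components. An isolated vertex has one face, which has no
boundary edge and is counted separately. -/
def IsPlane : Prop :=
  (Nat.card V : ℤ) - (G.edgeSet.ncard : ℤ)
      + ((Nat.card M.Face : ℤ) + ({v : V | ∀ w, ¬ G.Adj v w}.ncard : ℤ))
    = 2 * (Nat.card G.ConnectedComponent : ℤ)

/-- The darts, in both directions, of the edges of the triangular-block grown from the face of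
`d₀`: whenever an edge is in the block, so are all the edges of each `3`-face containing it. -/
inductive BlockDart (d₀ : G.Dart) : G.Dart → Prop
  | base : BlockDart d₀ d₀
  | reverse (d : G.Dart) : BlockDart d₀ d → BlockDart d₀ d.symm
  | grow (d : G.Dart) : BlockDart d₀ d → M.size (M.face d) = 3 → BlockDart d₀ (M.facePerm d)

/-- The subgraph formed by the edges of the triangular-block grown from the face of `d₀`. -/
def blockFrom (d₀ : G.Dart) : G.Subgraph where
  verts := {v | ∃ d, M.BlockDart d₀ d ∧ d.fst = v}
  Adj u v := ∃ d, M.BlockDart d₀ d ∧ d.fst = u ∧ d.snd = v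
  adj_sub := by
    rintro u v ⟨d, -, rfl, rfl⟩
    exact d.adj
  edge_vert := by
    rintro u v ⟨d, hd, rfl, -⟩
    exact ⟨d, hd, rfl⟩
  symm := ⟨by
    rintro u v ⟨d, hd, rfl, rfl⟩
    exact ⟨d.symm, .reverse d hd, rfl, rfl⟩⟩

/-- `B` is a triangular-block: it is grown from some `3`-face. -/
def IsTriangularBlock (B : G.Subgraph) : Prop :=
  ∃ d₀ : G.Dart, M.size (M.face d₀) = 3 ∧ B = M.blockFrom d₀

/-- The `3`-faces of the embedded graph `G` all of whose boundary edges belong to `B`. -/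
def threeFacesIn (B : G.Subgraph) : Set M.Face :=
  {f | M.size f = 3 ∧ ∀ d : G.Dart, M.face d = f → B.Adj d.fst d.snd}

/-- The graph is connected, all its faces are `3`-faces or `4`-faces, every triangular-block is a
copy of the icosahedron with `19` of its `20` triangles being faces of `G` (all of them but its outer
face), and every vertex lies in exactly one triangular-block. -/
structure IsIcosahedralPattern : Prop where
  connected : G.Connected
  face_size : ∀ f : M.Face, M.size f = 3 ∨ M.size f = 4
  block_iso : ∀ B : G.Subgraph, M.IsTriangularBlock B → Nonempty (B.coe ≃g icosahedron)
  block_faces : ∀ B : G.Subgraph, M.IsTriangularBlock B → (M.threeFacesIn B).ncard = 19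
  vertex_block : ∀ v : V, ∃! B : G.Subgraph, M.IsTriangularBlock B ∧ v ∈ B.verts

end RotationSystem

/-- A (finite) graph is planar if it has a rotation system of genus `0`. -/
def IsPlanar (G : SimpleGraph V) : Prop := ∃ M : RotationSystem G, M.IsPlane

open Classical in
/-- The planar Turán number `ex_P(n, H)`: the maximum number of edges of an `H`-free planar
graph on `n` vertices. -/
noncomputable def planarTuranNumber {W : Type*} (n : ℕ) (H : SimpleGraph W) : ℕ :=
  Finset.sup {G : SimpleGraph (Fin n) | IsPlanar G ∧ H.Free G} fun G => G.edgeSet.ncard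

end PlanarTuran

/-! Let x count the darts on 3-faces, I the vertices surrounded by 3-faces, O the outer darts, and κ
the triangular-blocks without boundary. Three 3-faces at a vertex whose pairs of neighbours are
disjoint form H_3, so at most five 3-faces meet at a surrounded vertex and at most four at any other
(`ncard_tri_le_four`). Weighing both cases yields 5x ≤ 19n + 6I + O (`five_mul_tri_le`).

The second ingredient is Euler's inequality for a block cut apart along its boundary
(`block_euler`). It needs no topology: an injective linear map (`blockMap_injective`) compares the
numbers of faces, vertices and edges. Summed over the blocks, with at least three outer darts in
each block that has a boundary, it gives 6I + O ≤ x + 12κ, hence 4x ≤ 19n + 12κ (`four_mul_tri_le`).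
Euler's formula turns this bound on 3-faces into one on edges (`edge_bound`). A disconnected graph
stays strictly below the bound; in a connected one a block without boundary would be the whole
graph, which is impossible for n ≥ 13.

Under equality every estimate is sharp at each vertex and block: a block has nine surrounded
vertices, each in five 3-faces, and three boundary vertices, each in four. Capping its boundary
triangle gives a triangulation of degree 5 on 12 vertices, which is the icosahedron
(`exists_icosahedron_labelling`). Conversely, the pattern fixes all the counts.

Equality forces 24 ∣ n because 67 and 24 are coprime. For n = 24k it is attained by a chain of k
links, each made of two icosahedra; its local configurations are finitely many and are checked by
`decide`, and its planarity is a numerical identity (`chain_isPlane`, `chain_free`). -/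

namespace PlanarTuran

/-! ### Cycles of a permutation as orbits of iterates. -/

section Perm

variable {α : Type*} [Finite α] (f : Equiv.Perm α)

lemma minimalPeriod_perm_pos (x : α) : 0 < Function.minimalPeriod f x :=
  Function.minimalPeriod_pos_of_mem_periodicPts (f.injective.mem_periodicPts x)

lemma exists_iterate_of_sameCycle {x y : α} (h : f.SameCycle x y) :
    ∃ i < Function.minimalPeriod f x, f^[i] x = y := by
  obtain ⟨i, rfl⟩ := h.exists_nat_pow_eq
  refine ⟨i % Function.minimalPeriod f x, Nat.mod_lt _ (minimalPeriod_perm_pos f x), ?_⟩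
  rw [Function.iterate_mod_minimalPeriod_eq, Equiv.Perm.iterate_eq_pow]

omit [Finite α] in
lemma sameCycle_iterate (x : α) (i : ℕ) : f.SameCycle x (f^[i] x) :=
  ⟨i, by rw [Equiv.Perm.iterate_eq_pow]; rfl⟩

lemma ncard_sameCycle (x : α) :
    {y | f.SameCycle x y}.ncard = Function.minimalPeriod f x := by
  have h : {y | f.SameCycle x y}
      = (fun i => f^[i] x) '' Set.Iio (Function.minimalPeriod f x) := by
    ext y
    constructor
    · intro h
      obtain ⟨i, hi, rfl⟩ := exists_iterate_of_sameCycle f h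
      exact ⟨i, hi, rfl⟩
    · rintro ⟨i, -, rfl⟩
      exact sameCycle_iterate f x i
  rw [h, Function.iterate_injOn_Iio_minimalPeriod.ncard_image]
  simp [Set.ncard_eq_toFinset_card']

end Perm

lemma dart_ext {V : Type*} {G : SimpleGraph V} {d e : G.Dart} (h₁ : d.fst = e.fst)
    (h₂ : d.snd = e.snd) : d = e := SimpleGraph.Dart.ext _ _ (Prod.ext h₁ h₂)

/-! ### Rotations, face walks and 3-faces. -/

namespace RotationSystem

variable {V : Type*} {G : SimpleGraph V} (M : RotationSystem G)

lemma facePerm_apply (d : G.Dart) : M.facePerm d = M.next d.symm := rfl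

lemma facePerm_symm_apply (d : G.Dart) : M.facePerm.symm d = (M.next.symm d).symm := rfl

@[simp] lemma next_fst (d : G.Dart) : (M.next d).fst = d.fst :=
  ((M.sameCycle_iff d (M.next d)).1 ⟨1, rfl⟩).symm

@[simp] lemma next_symm_fst (d : G.Dart) : (M.next.symm d).fst = d.fst := by
  conv_rhs => rw [← M.next.apply_symm_apply d, next_fst]

@[simp] lemma next_iterate_fst (d : G.Dart) (i : ℕ) : (M.next^[i] d).fst = d.fst := by
  induction i with
  | zero => rfl
  | succ i ih => rw [Function.iterate_succ_apply', next_fst, ih]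

@[simp] lemma next_symm_iterate_fst (d : G.Dart) (i : ℕ) : (M.next.symm^[i] d).fst = d.fst := by
  induction i with
  | zero => rfl
  | succ i ih => rw [Function.iterate_succ_apply', next_symm_fst, ih]

@[simp] lemma facePerm_fst (d : G.Dart) : (M.facePerm d).fst = d.snd := by
  rw [facePerm_apply, next_fst]; rfl

@[simp] lemma face_facePerm (d : G.Dart) : M.face (M.facePerm d) = M.face d :=
  Quotient.sound (s := Equiv.Perm.SameCycle.setoid M.facePerm)
    (show M.facePerm.SameCycle _ _ from ⟨-1, by simp⟩)

lemma face_eq_iff (d e : G.Dart) : M.face d = M.face e ↔ M.facePerm.SameCycle d e :=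
  Quotient.eq (r := Equiv.Perm.SameCycle.setoid M.facePerm)

lemma face_surjective : Function.Surjective M.face := Quotient.mk_surjective

/-- The face of `d` is a `3`-face. -/
def Tri (d : G.Dart) : Prop := M.size (M.face d) = 3

lemma tri_facePerm (d : G.Dart) : M.Tri (M.facePerm d) ↔ M.Tri d := by
  rw [Tri, Tri, face_facePerm]

lemma tri_next (d : G.Dart) : M.Tri (M.next d) ↔ M.Tri d.symm := by
  rw [← M.tri_facePerm d.symm, facePerm_apply, Dart.symm_symm]

variable [Finite V]

lemma finite_dart (G : SimpleGraph V) : Finite G.Dart :=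
  Finite.of_injective (fun d : G.Dart => d.toProd) fun _ _ h => SimpleGraph.Dart.ext _ _ h

attribute [local instance] finite_dart

lemma size_face (d : G.Dart) : M.size (M.face d) = Function.minimalPeriod M.facePerm d := by
  rw [← ncard_sameCycle, size]
  congr 1
  ext e
  rw [Set.mem_ofPred_eq, Set.mem_ofPred_eq, eq_comm, face_eq_iff]

variable {M}

lemma Tri.facePerm_three {d : G.Dart} (h : M.Tri d) :
    M.facePerm (M.facePerm (M.facePerm d)) = d := by
  have := Function.iterate_minimalPeriod (f := M.facePerm) (x := d)
  rwa [← size_face, show M.size (M.face d) = 3 from h] at this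

lemma Tri.facePerm_symm {d : G.Dart} (h : M.Tri d) :
    M.facePerm (M.facePerm d) = (M.next.symm d).symm := by
  rw [← facePerm_symm_apply, Equiv.eq_symm_apply, h.facePerm_three]

lemma Tri.facePerm_snd {d : G.Dart} (h : M.Tri d) :
    (M.facePerm d).snd = (M.next.symm d).snd := by
  rw [← facePerm_fst, h.facePerm_symm]; rfl

/-- The face of `d` occupies the corner between `M.next.symm d` and `d`; when it is a 3-face, its
third side joins the ends of these two darts. -/
lemma Tri.adj {d : G.Dart} (h : M.Tri d) : G.Adj (M.next.symm d).snd d.snd := by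
  have := (M.facePerm d).adj
  rw [facePerm_fst, h.facePerm_snd] at this
  exact this.symm

variable (M)

lemma size_face_ne_one (d : G.Dart) : M.size (M.face d) ≠ 1 := by
  rw [size_face, Ne, Function.minimalPeriod_eq_one_iff_isFixedPt]
  intro h
  have : (M.facePerm d).fst = d.fst := congrArg (·.fst) h
  rw [facePerm_fst] at this
  exact d.adj.ne this.symm

lemma size_face_pos (d : G.Dart) : 0 < M.size (M.face d) := by
  rw [size_face]; exact minimalPeriod_perm_pos _ _

lemma facePerm_eq_symm_of_size_two {d : G.Dart} (h : M.size (M.face d) = 2) :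
    M.facePerm d = d.symm := by
  have := Function.iterate_minimalPeriod (f := M.facePerm) (x := d)
  rw [← size_face, h] at this
  have this : M.facePerm (M.facePerm d) = d := this
  refine dart_ext (by simp [Dart.symm]) ?_
  rw [← facePerm_fst, this]; rfl

end RotationSystem

/-! ### Friendship graphs and the number of 3-faces at a vertex. -/

lemma not_free_friendshipGraph {V : Type*} {G : SimpleGraph V} {k : ℕ} (v : V)
    (f : Fin k × Bool → V) (hf : Function.Injective f) (hv : ∀ p, G.Adj v (f p))
    (hadj : ∀ i, G.Adj (f (i, false)) (f (i, true))) : ¬ (friendshipGraph k).Free G := by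
  intro h
  have hom : ∀ p q : Fin k × Bool, p ≠ q → p.1 = q.1 → G.Adj (f p) (f q) := by
    rintro ⟨i, b⟩ ⟨j, c⟩ hne (rfl : i = j)
    cases b <;> cases c
    · exact absurd rfl hne
    · exact hadj i
    · exact (hadj i).symm
    · exact absurd rfl hne
  refine h ⟨⟨⟨fun x => x.elim v f, ?_⟩, ?_⟩⟩
  · rintro (_ | p) (_ | q) hpq
    · exact absurd rfl hpq.1
    · exact hv q
    · exact (hv p).symm
    · exact hom p q (fun h => hpq.1 (congrArg some h)) (hpq.2 p q rfl rfl)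
  · rintro (_ | p) (_ | q) hpq
    · rfl
    · exact absurd hpq (hv q).ne
    · exact absurd hpq (hv p).ne'
    · exact congrArg some (hf hpq)

namespace RotationSystem

variable {V : Type*} [Finite V] {G : SimpleGraph V} (M : RotationSystem G)

attribute [local instance] finite_dart

lemma exists_next_iterate {d e : G.Dart} (h : d.fst = e.fst) :
    ∃ i < Function.minimalPeriod M.next d, M.next^[i] d = e :=
  exists_iterate_of_sameCycle _ ((M.sameCycle_iff d e).2 h)

/-- Apart from a given dart, at most four darts at a vertex can be followed by a `3`-face. -/
lemma ncard_tri_le_four (hG : (friendshipGraph 3).Free G) (e : G.Dart) :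
    {d : G.Dart | M.Tri d ∧ d.fst = e.fst ∧ d ≠ e}.ncard ≤ 4 := by
  classical
  by_contra! hlt
  set m := Function.minimalPeriod M.next e with hm
  set P := (Finset.range m).filter fun i => 1 ≤ i ∧ M.Tri (M.next^[i] e) with hP
  have hsub : {d : G.Dart | M.Tri d ∧ d.fst = e.fst ∧ d ≠ e}
      ⊆ ((P.image fun i => M.next^[i] e : Finset G.Dart) : Set G.Dart) := by
    rintro d ⟨hd, hde, hne⟩
    obtain ⟨i, hi, rfl⟩ := M.exists_next_iterate hde.symm
    rw [Finset.mem_coe, Finset.mem_image]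
    refine ⟨i, ?_, rfl⟩
    rw [hP, Finset.mem_filter, Finset.mem_range]
    refine ⟨hi, Nat.one_le_iff_ne_zero.2 ?_, hd⟩
    rintro rfl
    exact hne rfl
  have hcard : 5 ≤ P.card := by
    have h1 := Set.ncard_le_ncard hsub (Finset.finite_toSet _)
    rw [Set.ncard_coe_finset] at h1
    have h2 := Finset.card_image_le (s := P) (f := fun i => M.next^[i] e)
    omega
  obtain ⟨Q, hQP, hQ⟩ := Finset.exists_subset_card_eq hcard
  let q := Q.orderEmbOfFin hQ
  have hq : ∀ k, q k < m ∧ 1 ≤ q k ∧ M.Tri (M.next^[q k] e) := fun k => by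
    simpa [hP] using hQP (Q.orderEmbOfFin_mem hQ k)
  have hlt : ∀ {i j : Fin 5}, i < j → q i < q j := fun h => q.strictMono h
  -- The 3-faces at the first, third and fifth of the five positions, each giving the neighbours at
  -- its own and at the preceding position. Skipping one position in between keeps the pairs
  -- disjoint, and positions start at 1, so that no predecessor wraps around.
  let g : Fin 3 × Bool → ℕ := fun p =>
    if p.2 then q ⟨2 * p.1, by omega⟩ else q ⟨2 * p.1, by omega⟩ - 1
  have hgm : ∀ p, g p < m := by
    rintro ⟨k, b⟩
    have := hq ⟨2 * k, by omega⟩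
    cases b <;> simp [g] <;> omega
  have hg : Function.Injective g := by
    have key : ∀ (k l : Fin 3), k < l → ∀ b c, g (k, b) < g (l, c) := by
      intro k l hkl b c
      have h1 : q ⟨2 * k, by omega⟩ < q ⟨2 * k + 1, by omega⟩ := hlt (by simp)
      have h2 : q ⟨2 * k + 1, by omega⟩ < q ⟨2 * l, by omega⟩ := hlt (by simp; omega)
      cases b <;> cases c <;> simp [g] <;> omega
    rintro ⟨k, b⟩ ⟨l, c⟩ h
    rcases lt_trichotomy k l with hkl | rfl | hkl
    · exact absurd h (key k l hkl b c).ne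
    · have := hq ⟨2 * k, by omega⟩
      cases b <;> cases c <;> simp [g] at h ⊢ <;> omega
    · exact absurd h (key l k hkl c b).ne'
  refine not_free_friendshipGraph e.fst (fun p => (M.next^[g p] e).snd) ?_ ?_ ?_ hG
  · intro p p' h
    apply hg
    apply Function.iterate_injOn_Iio_minimalPeriod (f := M.next) (x := e) (hgm p) (hgm p')
    exact dart_ext (by simp) h
  · intro p
    simpa using (M.next^[g p] e).adj
  · intro k
    obtain ⟨-, h1, h2⟩ := hq ⟨2 * k, by omega⟩
    have := h2.adj
    obtain ⟨i, hi⟩ := Nat.exists_eq_add_of_le' h1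
    rw [hi, Function.iterate_succ_apply', Equiv.symm_apply_apply] at this
    simp only [g, hi]
    simpa [Function.iterate_succ_apply'] using this

/-! ### Interior vertices, outer darts and runs of 3-faces. -/

/-- All darts at `v` lie on `3`-faces, and there is at least one. -/
def Interior (v : V) : Prop := (∃ d : G.Dart, d.fst = v) ∧ ∀ d : G.Dart, d.fst = v → M.Tri d

/-- Darts which are not on a `3`-face, but whose reverse is. -/
def Outer (d : G.Dart) : Prop := ¬ M.Tri d ∧ M.Tri d.symm

variable {M}

lemma exists_start {d : G.Dart} (h : ¬ M.Interior d.fst) :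
    ∃ k, ¬ M.Tri (M.next.symm^[k] d) := by
  by_contra! hd
  refine h ⟨⟨d, rfl⟩, fun e he => ?_⟩
  obtain ⟨i, -, rfl⟩ := M.exists_next_iterate he
  obtain h1 := (Function.LeftInverse.iterate M.next.symm_apply_apply i) e
  rw [← h1]
  simpa using hd i

variable (M)

open Classical in
/-- The first dart of the run of `3`-faces around the initial vertex of `d` that reaches `d`. -/
noncomputable def start (d : G.Dart) : G.Dart :=
  if h : ∃ k, ¬ M.Tri (M.next.symm^[k] d) then M.next.symm^[Nat.find h] d else d

variable {M}

omit [Finite V] in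
@[simp] lemma start_fst (d : G.Dart) : (M.start d).fst = d.fst := by
  unfold start; split_ifs <;> simp

lemma exists_start_spec {d : G.Dart} (h : ¬ M.Interior d.fst) :
    ∃ k, M.next^[k] (M.start d) = d ∧ ¬ M.Tri (M.start d) ∧
      ∀ j, 1 ≤ j → j ≤ k → M.Tri (M.next^[j] (M.start d)) := by
  classical
  have hk := exists_start h
  have hs : M.start d = M.next.symm^[Nat.find hk] d := dif_pos hk
  have hl := fun i => (Function.LeftInverse.iterate M.next.apply_symm_apply i)
  refine ⟨Nat.find hk, ?_, ?_, ?_⟩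
  · rw [hs, hl]
  · rw [hs]; exact Nat.find_spec hk
  · intro j h1 h2
    have h3 := Nat.find_min hk (m := Nat.find hk - j) (by omega)
    rw [not_not] at h3
    have h4 : M.next.symm^[Nat.find hk] d = M.next.symm^[j] (M.next.symm^[Nat.find hk - j] d) := by
      rw [← Function.iterate_add_apply]; congr 1; omega
    rwa [hs, h4, hl]

omit [Finite V] in
lemma start_of_not_tri {d : G.Dart} (h : ¬ M.Tri d) : M.start d = d := by
  classical
  have hk : ∃ k, ¬ M.Tri (M.next.symm^[k] d) := ⟨0, h⟩
  rw [start, dif_pos hk, (Nat.find_eq_zero hk).2 h]; rfl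

lemma start_next {d : G.Dart} (hd : ¬ M.Interior d.fst) (h : M.Tri (M.next d)) :
    M.start (M.next d) = M.start d := by
  classical
  have hk := exists_start hd
  have hk' : ∃ k, ¬ M.Tri (M.next.symm^[k] (M.next d)) := by
    obtain ⟨k, hk⟩ := hk
    exact ⟨k + 1, by simpa using hk⟩
  rw [start, start, dif_pos hk, dif_pos hk', Nat.find_comp_succ (h₂ := by simpa using hk)
    (p := fun k => ¬ M.Tri (M.next.symm^[k] (M.next d)))]
  · simp
  · simpa using h

/-- If the backward search moves at all, the dart after the start is on a 3-face, and that face also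
contains the reverse of the start; otherwise `d` is its own start and only the second alternative of
`hd` is left. -/
lemma outer_start {d : G.Dart} (h : ¬ M.Interior d.fst) (hd : M.Tri d ∨ M.Tri d.symm) :
    M.Outer (M.start d) := by
  obtain ⟨k, hk, h1, h2⟩ := exists_start_spec h
  refine ⟨h1, ?_⟩
  rcases k with _ | k
  · rw [Function.iterate_zero, id] at hk
    rw [hk] at h1 ⊢
    exact hd.resolve_left h1
  · exact (M.tri_next _).1 (h2 1 le_rfl (by omega))

omit [Finite V] in
lemma Outer.not_interior {d : G.Dart} (h : M.Outer d) : ¬ M.Interior d.fst :=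
  fun hi => h.1 (hi.2 d rfl)

end RotationSystem

/-! ### Triangular-blocks as equivalence classes of darts. -/

namespace RotationSystem

variable {V : Type*} {G : SimpleGraph V} {M : RotationSystem G}

section

variable [Finite V]

attribute [local instance] finite_dart

omit [Finite V] in
lemma BlockDart.trans {a b c : G.Dart} (h₁ : M.BlockDart a b) (h₂ : M.BlockDart b c) :
    M.BlockDart a c := by
  induction h₂ with
  | base => exact h₁
  | reverse d _ ih => exact ih.reverse
  | grow d _ h ih => exact ih.grow d h

/-- Both generating moves are invertible by moves of the same kind: reversal is an involution, and
the step along a 3-face has order three. Hence blocks partition the darts. -/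
lemma BlockDart.symm {a b : G.Dart} (h : M.BlockDart a b) : M.BlockDart b a := by
  induction h with
  | base => exact .base
  | reverse d _ ih =>
    refine BlockDart.trans ?_ ih
    conv => arg 3; rw [← d.symm_symm]
    exact BlockDart.base.reverse
  | grow d _ h ih =>
    refine BlockDart.trans ?_ ih
    have h : M.Tri d := h
    conv => arg 3; rw [← h.facePerm_three]
    refine (BlockDart.grow _ (BlockDart.grow _ .base ?_) ?_)
    · exact (M.tri_facePerm d).2 h
    · exact (M.tri_facePerm _).2 ((M.tri_facePerm d).2 h)

omit [Finite V] in
lemma blockDart_symm_iff {b d : G.Dart} : M.BlockDart b d.symm ↔ M.BlockDart b d :=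
  ⟨fun h => by simpa using h.reverse, fun h => h.reverse⟩

lemma blockDart_facePerm_iff {b d : G.Dart} (h : M.Tri d) :
    M.BlockDart b (M.facePerm d) ↔ M.BlockDart b d :=
  ⟨fun hd => hd.trans (BlockDart.grow d .base h).symm, fun hd => hd.grow d h⟩

lemma blockDart_next_iff {b d : G.Dart} (h : M.Tri (M.next d)) :
    M.BlockDart b (M.next d) ↔ M.BlockDart b d := by
  rw [← blockDart_symm_iff (d := d), ← blockDart_facePerm_iff ((M.tri_next d).1 h),
    facePerm_apply, Dart.symm_symm]

omit [Finite V] in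
lemma BlockDart.tri_or {b d : G.Dart} (hb : M.Tri b) (h : M.BlockDart b d) :
    M.Tri d ∨ M.Tri d.symm := by
  induction h with
  | base => exact .inl hb
  | reverse d _ ih => rw [Dart.symm_symm]; exact ih.symm
  | grow d _ h ih => exact .inl ((M.tri_facePerm d).2 h)

/-- Consecutive 3-faces of a run share an edge, so the whole run with its start stays in one block.
-/
lemma blockDart_start_iff {b d : G.Dart} (h : ¬ M.Interior d.fst) :
    M.BlockDart b (M.start d) ↔ M.BlockDart b d := by
  obtain ⟨k, hk, -, ht⟩ := exists_start_spec h
  have key : ∀ j ≤ k, M.BlockDart b (M.next^[j] (M.start d)) ↔ M.BlockDart b (M.start d) := by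
    intro j hj
    induction j with
    | zero => rfl
    | succ j ih =>
      have := ht (j + 1) (by omega) hj
      rw [Function.iterate_succ_apply'] at this ⊢
      rw [blockDart_next_iff this, ih (by omega)]
  rw [← key k le_rfl, hk]

omit [Finite V] in
lemma BlockDart.eq_of_invariant {α : Type*} {b d : G.Dart} (h : M.BlockDart b d) (g : G.Dart → α)
    (h₁ : ∀ d, M.BlockDart b d → g d.symm = g d)
    (h₂ : ∀ d, M.BlockDart b d → M.Tri d → g (M.facePerm d) = g d) : g d = g b := by
  induction h with
  | base => rfl
  | reverse d hd ih => rw [h₁ d hd, ih]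
  | grow d hd h ih => rw [h₂ d hd h, ih]

end

/-! ### Euler's inequality for a block by linear algebra. -/

section Homology

variable (M) (b : G.Dart)

/-- The `3`-faces of the triangular-block of `b`. -/
abbrev BlockFace := {f : M.Face // M.size f = 3 ∧ ∃ d, M.BlockDart b d ∧ M.face d = f}

/-- The interior vertices of the triangular-block of `b`. -/
abbrev BlockInterior := {v : V // M.Interior v ∧ ∃ d, M.BlockDart b d ∧ d.fst = v}

/-- The outer darts of the triangular-block of `b`, which correspond to its boundary vertices. -/
abbrev BlockOuter := {d : G.Dart // M.BlockDart b d ∧ M.Outer d}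

open Classical in
/-- Extension by zero of a function on the `3`-faces of a block to the darts. -/
noncomputable def faceFun : (M.BlockFace b → ℚ) →ₗ[ℚ] (G.Dart → ℚ) :=
  LinearMap.pi fun d =>
    if h : M.BlockDart b d ∧ M.Tri d then LinearMap.proj ⟨M.face d, h.2, d, h.1, rfl⟩ else 0

variable [Finite V]

attribute [local instance] finite_dart Fintype.ofFinite

variable {b} in
open Classical in
/-- Extension of a function on the vertices of the block of `b`, cut apart along its boundary, to
the darts. -/
noncomputable def vertexFun (hb : M.Tri b) :
    (M.BlockInterior b ⊕ M.BlockOuter b → ℚ) →ₗ[ℚ] (G.Dart → ℚ) :=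
  LinearMap.pi fun d =>
    if h : M.BlockDart b d then
      if hi : M.Interior d.fst then LinearMap.proj (Sum.inl ⟨d.fst, hi, d, h, rfl⟩)
      else LinearMap.proj (Sum.inr ⟨M.start d, (blockDart_start_iff hi).2 h,
        outer_start hi (h.tri_or hb)⟩)
    else 0

variable {M b}

omit [Finite V] in
lemma faceFun_of_mem (f : M.BlockFace b → ℚ) {d : G.Dart} (h : M.BlockDart b d) (ht : M.Tri d) :
    M.faceFun b f d = f ⟨M.face d, ht, d, h, rfl⟩ := by
  simp [faceFun, h, ht]

omit [Finite V] in
lemma faceFun_of_not (f : M.BlockFace b → ℚ) {d : G.Dart} (h : ¬ (M.BlockDart b d ∧ M.Tri d)) :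
    M.faceFun b f d = 0 := by
  simp only [faceFun, LinearMap.pi_apply, dif_neg h, LinearMap.zero_apply]

/-- `M.next d` and `d.symm` lie on the same face; off the block or off the 3-faces both values are
zero. -/
lemma faceFun_next (f : M.BlockFace b → ℚ) (d : G.Dart) :
    M.faceFun b f (M.next d) = M.faceFun b f d.symm := by
  by_cases ht : M.Tri d.symm
  · have ht' := (M.tri_next d).2 ht
    by_cases hd : M.BlockDart b d
    · rw [faceFun_of_mem f ((blockDart_next_iff ht').2 hd) ht',
        faceFun_of_mem f (blockDart_symm_iff.2 hd) ht]
      congr 2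
      rw [← face_facePerm M d.symm]; rfl
    · rw [faceFun_of_not, faceFun_of_not]
      · exact fun h => hd (blockDart_symm_iff.1 h.1)
      · exact fun h => hd ((blockDart_next_iff ht').1 h.1)
  · rw [faceFun_of_not _ fun h => ht h.2, faceFun_of_not _ fun h => ht ((M.tri_next d).1 h.2)]

variable (hb : M.Tri b)

lemma vertexFun_of_not (c : M.BlockInterior b ⊕ M.BlockOuter b → ℚ) {d : G.Dart}
    (h : ¬ M.BlockDart b d) : M.vertexFun hb c d = 0 := by
  simp [vertexFun, h]

lemma vertexFun_interior (c : M.BlockInterior b ⊕ M.BlockOuter b → ℚ) {d : G.Dart}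
    (h : M.BlockDart b d) (hi : M.Interior d.fst) :
    M.vertexFun hb c d = c (Sum.inl ⟨d.fst, hi, d, h, rfl⟩) := by
  simp [vertexFun, h, hi]

lemma vertexFun_boundary (c : M.BlockInterior b ⊕ M.BlockOuter b → ℚ) {d : G.Dart}
    (h : M.BlockDart b d) (hi : ¬ M.Interior d.fst) :
    M.vertexFun hb c d = c (Sum.inr ⟨M.start d, (blockDart_start_iff hi).2 h,
        outer_start hi (h.tri_or hb)⟩) := by
  simp [vertexFun, h, hi]

/-- Crossing the corner of a 3-face does not leave the copy of the vertex. Only a gap between two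
runs can separate copies, which is how the block is cut apart along its boundary. -/
lemma vertexFun_next (c : M.BlockInterior b ⊕ M.BlockOuter b → ℚ) {d : G.Dart}
    (ht : M.Tri (M.next d)) : M.vertexFun hb c (M.next d) = M.vertexFun hb c d := by
  by_cases hd : M.BlockDart b d
  · have hd' := (blockDart_next_iff ht).2 hd
    by_cases hi : M.Interior d.fst
    · rw [vertexFun_interior hb c hd hi, vertexFun_interior hb c hd' (by simpa using hi)]
      congr 3; simp
    · rw [vertexFun_boundary hb c hd hi, vertexFun_boundary hb c hd' (by simpa using hi)]
      congr 3; exact start_next hi ht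
  · rw [vertexFun_of_not hb c hd, vertexFun_of_not hb c fun h => hd ((blockDart_next_iff ht).1 h)]

lemma sum_symm (g : G.Dart → ℚ) : ∑ d : G.Dart, g d.symm = ∑ d, g d :=
  Equiv.sum_comp (rev G) g

/-- The discrete form of "the boundary of a boundary is zero": boundaries of faces are orthogonal to
differences of vertex functions. Reindexing by the rotation and by reversal identifies all four sums
of the expanded product. -/
lemma faceFun_vertexFun_orthogonal (f : M.BlockFace b → ℚ)
    (c : M.BlockInterior b ⊕ M.BlockOuter b → ℚ) :
    ∑ d : G.Dart, (M.faceFun b f d - M.faceFun b f d.symm)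
      * (M.vertexFun hb c d - M.vertexFun hb c d.symm) = 0 := by
  set F := M.faceFun b f with hF
  set H := M.vertexFun hb c with hH
  have h1 : ∑ d : G.Dart, F d.symm * H d = ∑ d : G.Dart, F d * H d := by
    rw [← Equiv.sum_comp M.next fun d => F d * H d]
    refine Finset.sum_congr rfl fun d _ => ?_
    rw [hF, faceFun_next]
    by_cases ht : M.Tri (M.next d)
    · rw [hH, vertexFun_next hb c ht]
    · rw [faceFun_of_not, zero_mul, zero_mul]
      exact fun h => ht ((M.tri_next d).2 h.2)
  have h2 : ∑ d : G.Dart, F d * H d.symm = ∑ d : G.Dart, F d * H d := by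
    rw [← h1, ← sum_symm fun d => F d.symm * H d]; simp
  have h3 : ∑ d : G.Dart, F d.symm * H d.symm = ∑ d : G.Dart, F d * H d :=
    sum_symm fun d => F d * H d
  simp only [sub_mul, mul_sub, Finset.sum_sub_distrib, h1, h2, h3]
  ring

/-- A map whose injectivity expresses that a triangular-block is connected and has no closed
proper part. -/
noncomputable def blockMap (pos : G.Dart → Prop) :
    ((M.BlockFace b → ℚ) × (M.BlockInterior b ⊕ M.BlockOuter b → ℚ)) →ₗ[ℚ]
      ({d : G.Dart // M.BlockDart b d ∧ pos d} → ℚ) × ℚ ×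
        ({_u : Unit // ∀ d, M.BlockDart b d → ¬ M.Outer d} → ℚ) :=
  (((LinearMap.funLeft ℚ ℚ Subtype.val).comp
      (LinearMap.id - LinearMap.funLeft ℚ ℚ Dart.symm)).comp
    ((M.faceFun b).coprod (M.vertexFun hb))).prod
  (((LinearMap.proj b).comp ((M.vertexFun hb).comp (LinearMap.snd ..))).prod
    (LinearMap.pi fun _ => (LinearMap.proj b).comp ((M.faceFun b).comp (LinearMap.fst ..))))

/-- On the kernel the face part and the vertex part cancel on every edge; being orthogonal, both
vanish. So the two functions do not change along the block and are constant. The vertex constant is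
killed by its value at `b`; the face constant by an outer dart, where the extension is zero, or by
the extra coordinate if there is none. -/
lemma blockMap_injective {pos : G.Dart → Prop} (hpos : ∀ d, ¬ pos d → pos d.symm) :
    Function.Injective (blockMap hb pos) := by
  rw [injective_iff_map_eq_zero]
  rintro ⟨f, c⟩ h
  set F := M.faceFun b f with hF
  set H := M.vertexFun hb c with hH
  have hP : ∀ d, M.BlockDart b d → pos d → F d + H d - (F d.symm + H d.symm) = 0 :=
    fun d h1 h2 => congrFun (congrArg Prod.fst h) ⟨d, h1, h2⟩
  have hHb : H b = 0 := congrArg (fun z => z.2.1) h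
  have hFb : (∀ d, M.BlockDart b d → ¬ M.Outer d) → F b = 0 :=
    fun h1 => congrFun (congrArg (fun z => z.2.2) h) ⟨(), h1⟩
  have hall : ∀ d, (F d - F d.symm) + (H d - H d.symm) = 0 := by
    intro d
    by_cases hd : M.BlockDart b d
    · by_cases hp : pos d
      · linarith [hP d hd hp]
      · have := hP d.symm hd.reverse (hpos d hp)
        rw [Dart.symm_symm] at this
        linarith
    · have hd' : ¬ M.BlockDart b d.symm := fun h => hd (blockDart_symm_iff.1 h)
      rw [hH, vertexFun_of_not hb c hd, vertexFun_of_not hb c hd', hF,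
        faceFun_of_not f fun h => hd h.1, faceFun_of_not f fun h => hd' h.1]
      ring
  have horth := faceFun_vertexFun_orthogonal hb f c
  rw [← hF, ← hH] at horth
  have hsq : ∑ d : G.Dart, (F d - F d.symm) ^ 2 = 0 := by
    rw [← neg_eq_zero, ← horth, ← Finset.sum_neg_distrib]
    refine Finset.sum_congr rfl fun d _ => ?_
    rw [show H d - H d.symm = -(F d - F d.symm) by linarith [hall d]]
    ring
  have hFs : ∀ d, F d.symm = F d := by
    intro d
    have := (Finset.sum_eq_zero_iff_of_nonneg fun d _ => sq_nonneg (F d - F d.symm)).1 hsq d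
      (Finset.mem_univ d)
    rw [sq_eq_zero_iff] at this
    linarith
  have hHs : ∀ d, H d.symm = H d := fun d => by linarith [hall d, hFs d]
  have hH0 : ∀ d, M.BlockDart b d → H d = 0 := by
    intro d hd
    rw [hd.eq_of_invariant H (fun d _ => hHs d), hHb]
    intro d _ ht
    rw [hH, facePerm_apply, vertexFun_next hb c ((M.tri_next _).2 (by rwa [Dart.symm_symm]))]
    exact hHs d
  have hFc : ∀ d, M.BlockDart b d → F d = F b := by
    intro d hd
    refine hd.eq_of_invariant F (fun d _ => hFs d) ?_
    intro d _ ht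
    rw [hF, facePerm_apply, faceFun_next, Dart.symm_symm]
  have hF0 : ∀ d, M.BlockDart b d → F d = 0 := by
    intro d hd
    rw [hFc d hd]
    by_cases ho : ∀ d, M.BlockDart b d → ¬ M.Outer d
    · exact hFb ho
    · push Not at ho
      obtain ⟨e, he, ho⟩ := ho
      rw [← hFc e he, hF, faceFun_of_not f fun h => ho.1 h.2]
  refine Prod.ext (funext ?_) (funext ?_)
  · rintro ⟨_, ht, d, hd, rfl⟩
    have := hF0 d hd
    rwa [hF, faceFun_of_mem f hd ht] at this
  · rintro (⟨_, hi, d, hd, rfl⟩ | ⟨d, hd, ho⟩)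
    · have := hH0 d hd
      rwa [hH, vertexFun_interior hb c hd hi] at this
    · have := hH0 d hd
      rw [hH, vertexFun_boundary hb c hd ho.not_interior] at this
      simpa [start_of_not_tri ho.1] using this

end Homology

end RotationSystem

/-! ### From dimensions to counts of darts. -/

lemma card_subtype_eq_ncard {α : Type*} (p : α → Prop) : Nat.card {x // p x} = {x | p x}.ncard :=
  Nat.card_coe_set_eq {x | p x}

lemma ncard_preimage_eq_mul {α β : Type*} [Finite α] [Finite β] (f : α → β) (s : Set β) (k : ℕ)
    (h : ∀ b ∈ s, {a | f a = b}.ncard = k) : {a | f a ∈ s}.ncard = k * s.ncard := by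
  classical
  have := Fintype.ofFinite α
  have := Fintype.ofFinite β
  rw [Set.ncard_eq_toFinset_card', Set.ncard_eq_toFinset_card',
    Finset.card_eq_sum_card_fiberwise (f := f) (t := s.toFinset) (by intro a; simp),
    Finset.sum_congr rfl (g := fun _ => k), Finset.sum_const, smul_eq_mul, mul_comm]
  intro b hb
  rw [Set.mem_toFinset] at hb
  rw [← h b hb, Set.ncard_eq_toFinset_card']
  congr 1
  ext a
  simp only [Finset.mem_filter, Set.mem_toFinset, Set.mem_ofPred_eq]
  exact ⟨fun h => h.2, fun h => ⟨h ▸ hb, h⟩⟩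

/-- One dart is selected from each edge, so that functions on selected darts form a space whose
dimension is the number of edges. -/
lemma exists_orientation {V : Type*} (G : SimpleGraph V) :
    ∃ pos : G.Dart → Prop, ∀ d, pos d.symm ↔ ¬ pos d := by
  refine ⟨fun d => WellOrderingRel d.fst d.snd, fun d => ?_⟩
  constructor
  · exact fun h h' => asymm_of WellOrderingRel h h'
  · intro h
    rcases trichotomous_of WellOrderingRel d.fst d.snd with h' | h' | h'
    · exact absurd h' h
    · exact absurd h' d.adj.ne
    · exact h'

namespace RotationSystem

variable {V : Type*} [Finite V] {G : SimpleGraph V} {M : RotationSystem G}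

attribute [local instance] finite_dart

lemma finite_face (M : RotationSystem G) : Finite M.Face :=
  Finite.of_surjective M.face M.face_surjective

attribute [local instance] finite_face

lemma ncard_dart_of_faces (s : Set M.Face) (k : ℕ) (h : ∀ f ∈ s, M.size f = k) :
    {d | M.face d ∈ s}.ncard = k * s.ncard :=
  ncard_preimage_eq_mul M.face s k h

lemma two_mul_ncard_pos {pos : G.Dart → Prop} (hpos : ∀ d, pos d.symm ↔ ¬ pos d)
    {X : Set G.Dart} (hX : ∀ d, d.symm ∈ X ↔ d ∈ X) :
    2 * {d | d ∈ X ∧ pos d}.ncard = X.ncard := by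
  have h1 : {d | d ∈ X ∧ ¬ pos d}.ncard = {d | d ∈ X ∧ pos d}.ncard := by
    rw [← Set.ncard_image_of_injective {d | d ∈ X ∧ pos d} (rev G).injective]
    congr 1
    ext d
    constructor
    · rintro ⟨h, hp⟩
      exact ⟨d.symm, ⟨(hX d).2 h, (hpos d).2 hp⟩, d.symm_symm⟩
    · rintro ⟨e, ⟨h, hp⟩, rfl⟩
      exact ⟨(hX e).2 h, fun h' => (hpos e).1 h' hp⟩
  have h2 : X = {d | d ∈ X ∧ pos d} ∪ {d | d ∈ X ∧ ¬ pos d} := by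
    ext d
    simp only [Set.mem_union, Set.mem_ofPred_eq]
    tauto
  have h3 : Disjoint {d | d ∈ X ∧ pos d} {d | d ∈ X ∧ ¬ pos d} :=
    Set.disjoint_left.2 fun d h h' => h'.2 h.2
  conv_rhs => rw [h2, Set.ncard_union_eq h3, h1]
  ring

lemma BlockDart.of_face {b d e : G.Dart} (h : M.BlockDart b d) (ht : M.Tri d)
    (hde : M.face d = M.face e) : M.BlockDart b e := by
  obtain ⟨i, -, rfl⟩ := exists_iterate_of_sameCycle _ ((M.face_eq_iff d e).1 hde)
  clear hde
  have key : ∀ i, M.BlockDart b (M.facePerm^[i] d) ∧ M.Tri (M.facePerm^[i] d) := by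
    intro i
    induction i with
    | zero => exact ⟨h, ht⟩
    | succ i ih =>
      rw [Function.iterate_succ_apply']
      exact ⟨ih.1.grow _ ih.2, (M.tri_facePerm _).2 ih.2⟩
  exact (key i).1

lemma three_mul_ncard_blockFace (b : G.Dart) :
    3 * {f | M.size f = 3 ∧ ∃ d, M.BlockDart b d ∧ M.face d = f}.ncard
      = {d | M.BlockDart b d ∧ M.Tri d}.ncard := by
  rw [← ncard_dart_of_faces _ 3 fun f hf => hf.1]
  congr 1
  ext d
  constructor
  · rintro ⟨h, e, he, hed⟩
    exact ⟨he.of_face (by rw [Tri, hed]; exact h) hed, h⟩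
  · rintro ⟨h, ht⟩
    exact ⟨ht, d, h, rfl⟩

lemma ncard_blockDart {b : G.Dart} (hb : M.Tri b) :
    {d | M.BlockDart b d}.ncard
      = {d | M.BlockDart b d ∧ M.Tri d}.ncard + {d | M.BlockDart b d ∧ M.Outer d}.ncard := by
  rw [← Set.ncard_union_eq]
  · congr 1
    ext d
    simp only [Set.mem_union, Set.mem_ofPred_eq, Outer]
    constructor
    · intro h
      have := h.tri_or hb
      tauto
    · tauto
  · exact Set.disjoint_left.2 fun d h h' => h'.2.1 h.2

open Classical in
/-- Euler's inequality for a triangular-block, in terms of the numbers of its interior vertices, of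
its boundary vertices and of its pairs of a `3`-face and an edge. -/
lemma block_euler {b : G.Dart} (hb : M.Tri b) :
    6 * {v | M.Interior v ∧ ∃ d, M.BlockDart b d ∧ d.fst = v}.ncard
      + 3 * {d | M.BlockDart b d ∧ M.Outer d}.ncard
    ≤ 6 + (if ∀ d, M.BlockDart b d → ¬ M.Outer d then 6 else 0)
      + {d | M.BlockDart b d ∧ M.Tri d}.ncard := by
  obtain ⟨pos, hpos⟩ := exists_orientation G
  have h := LinearMap.finrank_le_finrank_of_injective
    (blockMap_injective hb (pos := pos) fun d => (hpos d).2)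
  have := Fintype.ofFinite (M.BlockFace b)
  have := Fintype.ofFinite (M.BlockInterior b ⊕ M.BlockOuter b)
  have := Fintype.ofFinite {d : G.Dart // M.BlockDart b d ∧ pos d}
  rw [Module.finrank_prod, Module.finrank_prod, Module.finrank_prod, Module.finrank_fintype_fun_eq_card,
    Module.finrank_fintype_fun_eq_card, Module.finrank_fintype_fun_eq_card,
    Module.finrank_fintype_fun_eq_card, Module.finrank_self, ← Nat.card_eq_fintype_card,
    ← Nat.card_eq_fintype_card, ← Nat.card_eq_fintype_card, ← Nat.card_eq_fintype_card,
    Nat.card_sum, card_subtype_eq_ncard, card_subtype_eq_ncard, card_subtype_eq_ncard,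
    card_subtype_eq_ncard, card_subtype_eq_ncard] at h
  -- The dimensions give faces + interior vertices + outer darts ≤ edges + 1, with one more on the
  -- right for a closed block. With T block darts on 3-faces and O outer ones, 3 · faces = T and 2 ·
  -- edges = T + O; clearing denominators multiplies by 6.
  have h1 := two_mul_ncard_pos hpos (X := {d | M.BlockDart b d}) fun d => blockDart_symm_iff
  have h2 := three_mul_ncard_blockFace (M := M) b
  have h3 := ncard_blockDart hb
  simp only [Set.mem_ofPred_eq] at h1
  have h4 : {_u : Unit | ∀ d, M.BlockDart b d → ¬ M.Outer d}.ncard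
      = if ∀ d, M.BlockDart b d → ¬ M.Outer d then 1 else 0 := by
    split_ifs with h
    · rw [Set.ncard_eq_one]
      exact ⟨(), Set.eq_singleton_iff_unique_mem.2 ⟨h, fun _ _ => rfl⟩⟩
    · simp [h]
  rw [h4] at h
  split_ifs at h ⊢ <;> omega

/-! ### The boundary walk of a block. -/

omit [Finite V] in
lemma Outer.not_interior_snd {d : G.Dart} (h : M.Outer d) : ¬ M.Interior d.snd := by
  intro hi
  have h1 := hi.2 (M.next d.symm) (by simp [Dart.symm])
  rw [tri_next, Dart.symm_symm] at h1
  exact h.1 h1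

/-- The outer dart following an outer dart on the boundary of its triangular-block. -/
noncomputable def boundaryNext (M : RotationSystem G) (d : G.Dart) : G.Dart := M.start d.symm

omit [Finite V] in
@[simp] lemma boundaryNext_fst (d : G.Dart) : (M.boundaryNext d).fst = d.snd := by
  simp [boundaryNext, Dart.symm]

lemma Outer.boundaryNext {d : G.Dart} (h : M.Outer d) : M.Outer (M.boundaryNext d) :=
  outer_start (d := d.symm) h.not_interior_snd (.inl h.2)

lemma Outer.blockDart_boundaryNext {b d : G.Dart} (h : M.Outer d) (hd : M.BlockDart b d) :
    M.BlockDart b (M.boundaryNext d) :=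
  (blockDart_start_iff (d := d.symm) h.not_interior_snd).2 hd.reverse

omit [Finite V] in
lemma boundaryNext_ne (d : G.Dart) : M.boundaryNext d ≠ d := by
  intro h
  have := congrArg (·.fst) h
  simp only [boundaryNext_fst] at this
  exact d.adj.ne this.symm

/-- In a simple graph a closed walk of length two runs back along its edge, but the reverse of an
outer dart is on a 3-face and so is not outer. -/
lemma Outer.boundaryNext_two_ne {d : G.Dart} (h : M.Outer d) :
    M.boundaryNext (M.boundaryNext d) ≠ d := by
  intro h1
  have h2 : M.boundaryNext d = d.symm := by
    refine dart_ext (by simp [Dart.symm]) ?_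
    rw [← boundaryNext_fst, h1]; rfl
  exact h.boundaryNext.1 (h2 ▸ h.2)

lemma three_le_ncard_outer {b d : G.Dart} (hd : M.BlockDart b d) (h : M.Outer d) :
    3 ≤ {d | M.BlockDart b d ∧ M.Outer d}.ncard := by
  classical
  have hsub : (({d, M.boundaryNext d, M.boundaryNext (M.boundaryNext d)} : Finset G.Dart) :
      Set G.Dart) ⊆ {d | M.BlockDart b d ∧ M.Outer d} := by
    intro e he
    simp only [Finset.coe_insert, Finset.coe_singleton, Set.mem_insert_iff,
      Set.mem_singleton_iff] at he
    have h1 := h.blockDart_boundaryNext hd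
    rcases he with rfl | rfl | rfl
    · exact ⟨hd, h⟩
    · exact ⟨h1, h.boundaryNext⟩
    · exact ⟨h.boundaryNext.blockDart_boundaryNext h1, h.boundaryNext.boundaryNext⟩
  have := Set.ncard_le_ncard hsub
  rwa [Set.ncard_coe_finset, Finset.card_eq_three.2 ⟨_, _, _, (boundaryNext_ne d).symm,
    h.boundaryNext_two_ne.symm, (boundaryNext_ne _).symm, rfl⟩] at this

lemma boundaryNext_three {b d : G.Dart} (hd : M.BlockDart b d) (h : M.Outer d)
    (h3 : {d | M.BlockDart b d ∧ M.Outer d}.ncard = 3) :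
    M.boundaryNext (M.boundaryNext (M.boundaryNext d)) = d := by
  by_contra hne
  classical
  have h1 := h.blockDart_boundaryNext hd
  have h2 := h.boundaryNext.blockDart_boundaryNext h1
  have hsub : (({M.boundaryNext (M.boundaryNext (M.boundaryNext d)), d, M.boundaryNext d,
      M.boundaryNext (M.boundaryNext d)} : Finset G.Dart) :
      Set G.Dart) ⊆ {d | M.BlockDart b d ∧ M.Outer d} := by
    intro e he
    simp only [Finset.coe_insert, Finset.coe_singleton, Set.mem_insert_iff,
      Set.mem_singleton_iff] at he
    rcases he with rfl | rfl | rfl | rfl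
    · exact ⟨h.boundaryNext.boundaryNext.blockDart_boundaryNext h2,
        h.boundaryNext.boundaryNext.boundaryNext⟩
    · exact ⟨hd, h⟩
    · exact ⟨h1, h.boundaryNext⟩
    · exact ⟨h2, h.boundaryNext.boundaryNext⟩
  have := Set.ncard_le_ncard hsub
  rw [Set.ncard_coe_finset, h3, Finset.card_insert_of_notMem, Finset.card_eq_three.2
    ⟨_, _, _, (boundaryNext_ne d).symm, h.boundaryNext_two_ne.symm, (boundaryNext_ne _).symm, rfl⟩]
    at this
  · omega
  · simp only [Finset.mem_insert, Finset.mem_singleton, not_or]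
    exact ⟨hne, h.boundaryNext.boundaryNext_two_ne, boundaryNext_ne _⟩

end RotationSystem

/-! ### Summation over vertices and over blocks. -/

lemma ncard_eq_sum_fiber {α β : Type*} [Finite α] [DecidableEq β] (A : Set α) (f : α → β)
    (B : Finset β) (h : ∀ a ∈ A, f a ∈ B) :
    A.ncard = ∑ b ∈ B, {a | a ∈ A ∧ f a = b}.ncard := by
  classical
  have := Fintype.ofFinite α
  rw [Set.ncard_eq_toFinset_card', Finset.card_eq_sum_card_fiberwise (f := f) (t := B)
    (by intro a ha; exact h a (by simpa using ha))]
  refine Finset.sum_congr rfl fun b _ => ?_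
  rw [Set.ncard_eq_toFinset_card']
  congr 1
  ext a
  simp

namespace RotationSystem

variable {V : Type*} [Finite V] {G : SimpleGraph V} {M : RotationSystem G}

attribute [local instance] finite_dart finite_face

section Local

variable (M) in
/-- The number of darts at `v` on `3`-faces. -/
noncomputable def triDegree (v : V) : ℕ := {d | M.Tri d ∧ d.fst = v}.ncard

variable (M) in
/-- The number of outer darts at `v`. -/
noncomputable def outerDegree (v : V) : ℕ := {d | M.Outer d ∧ d.fst = v}.ncard

lemma triDegree_le_five (hG : (friendshipGraph 3).Free G) (v : V) : M.triDegree v ≤ 5 := by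
  by_cases h : ∃ e : G.Dart, e.fst = v
  · obtain ⟨e, rfl⟩ := h
    have h1 := M.ncard_tri_le_four hG e
    have h2 : {d | M.Tri d ∧ d.fst = e.fst}
        ⊆ insert e {d : G.Dart | M.Tri d ∧ d.fst = e.fst ∧ d ≠ e} := by
      intro d hd
      by_cases hde : d = e
      · exact Or.inl hde
      · exact Or.inr ⟨hd.1, hd.2, hde⟩
    have h3 := Set.ncard_le_ncard h2
    have h4 := Set.ncard_insert_le e {d : G.Dart | M.Tri d ∧ d.fst = e.fst ∧ d ≠ e}
    rw [triDegree]; omega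
  · push Not at h
    rw [triDegree, (Set.ncard_eq_zero).2]
    · omega
    · ext d
      simpa using fun _ => h d

lemma triDegree_le_four (hG : (friendshipGraph 3).Free G) {v : V} (hv : ¬ M.Interior v) :
    M.triDegree v ≤ 4 := by
  rcases Nat.eq_zero_or_pos (M.triDegree v) with h | h
  · omega
  · obtain ⟨d, -, hd⟩ := (Set.ncard_pos).1 h
    have : ∃ e : G.Dart, e.fst = v ∧ ¬ M.Tri e := by
      by_contra! h
      exact hv ⟨⟨d, hd⟩, h⟩
    obtain ⟨e, rfl, he⟩ := this
    refine le_trans (Set.ncard_le_ncard ?_) (M.ncard_tri_le_four hG e)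
    rintro d ⟨h1, h2⟩
    exact ⟨h1, h2, fun h => he (h ▸ h1)⟩

lemma outerDegree_pos {v : V} (hv : ¬ M.Interior v) (h : 0 < M.triDegree v) :
    0 < M.outerDegree v := by
  obtain ⟨d, hd, rfl⟩ := (Set.ncard_pos).1 h
  exact (Set.ncard_pos).2 ⟨M.start d, outer_start hv (.inl hd), start_fst d⟩

-- The weights are chosen to be sharp in both extremal cases: 5 · 5 = 19 + 6 at an interior vertex,
-- and 5 · 4 = 19 + 1 at a boundary vertex with a single run of 3-faces.
open Classical in
lemma five_mul_triDegree_le (hG : (friendshipGraph 3).Free G) (v : V) :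
    5 * M.triDegree v ≤ 19 + 6 * (if M.Interior v then 1 else 0) + M.outerDegree v := by
  split_ifs with hv
  · have := M.triDegree_le_five hG v
    omega
  · have h1 := M.triDegree_le_four hG hv
    have h2 := M.outerDegree_pos hv
    omega

end Local

section Blocks

variable (M) in
/-- The darts of the triangular-blocks. -/
def blockSets : Set (Set G.Dart) := (fun b => {d | M.BlockDart b d}) '' {b | M.Tri b}

lemma blockDart_eq_iff {b d : G.Dart} :
    {e | M.BlockDart d e} = {e | M.BlockDart b e} ↔ M.BlockDart b d := by
  constructor
  · intro h
    have : d ∈ {e | M.BlockDart b e} := h ▸ BlockDart.base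
    exact this
  · intro h
    ext e
    exact ⟨fun h' => h.trans h', fun h' => h.symm.trans h'⟩

/-- The number of outer darts of a set. -/
noncomputable def outerCount (M : RotationSystem G) (q : Set G.Dart) : ℕ :=
  {d | d ∈ q ∧ M.Outer d}.ncard

/-- The number of darts of a set that are on `3`-faces. -/
noncomputable def triCount (M : RotationSystem G) (q : Set G.Dart) : ℕ :=
  {d | d ∈ q ∧ M.Tri d}.ncard

/-- The number of interior vertices with a dart in a given set. -/
noncomputable def interiorCount (M : RotationSystem G) (q : Set G.Dart) : ℕ :=
  {v | M.Interior v ∧ ∃ d, d ∈ q ∧ d.fst = v}.ncard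

variable (M) in
/-- The triangular-blocks without boundary. -/
def closedBlocks : Set (Set G.Dart) := {q | q ∈ M.blockSets ∧ ∀ d ∈ q, ¬ M.Outer d}

lemma mem_blockSets {d : G.Dart} (h : M.Tri d ∨ M.Tri d.symm) :
    {e | M.BlockDart d e} ∈ M.blockSets := by
  rcases h with h | h
  · exact ⟨d, h, rfl⟩
  · exact ⟨d.symm, h, blockDart_eq_iff.2 BlockDart.base.reverse⟩

lemma blockDart_of_interior {d e : G.Dart} (h : M.Interior d.fst) (he : d.fst = e.fst) :
    M.BlockDart d e := by
  obtain ⟨i, -, rfl⟩ := M.exists_next_iterate he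
  clear he
  induction i with
  | zero => exact .base
  | succ i ih =>
    rw [Function.iterate_succ_apply', blockDart_next_iff]
    · exact ih
    · exact h.2 _ (by simp)

lemma sum_triCount (B : Finset (Set G.Dart)) (hB : (B : Set (Set G.Dart)) = M.blockSets) :
    {d | M.Tri d}.ncard = ∑ q ∈ B, M.triCount q := by
  classical
  rw [ncard_eq_sum_fiber {d | M.Tri d} (fun d => {e | M.BlockDart d e}) B]
  · refine Finset.sum_congr rfl fun q hq => ?_
    rw [← Finset.mem_coe, hB] at hq
    obtain ⟨b, hb, rfl⟩ := hq
    rw [triCount]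
    congr 1
    ext d
    simp only [Set.mem_ofPred_eq, blockDart_eq_iff]
    tauto
  · intro d hd
    rw [← Finset.mem_coe, hB]
    exact mem_blockSets (.inl hd)

lemma sum_outerCount (B : Finset (Set G.Dart)) (hB : (B : Set (Set G.Dart)) = M.blockSets) :
    {d | M.Outer d}.ncard = ∑ q ∈ B, M.outerCount q := by
  classical
  rw [ncard_eq_sum_fiber {d | M.Outer d} (fun d => {e | M.BlockDart d e}) B]
  · refine Finset.sum_congr rfl fun q hq => ?_
    rw [← Finset.mem_coe, hB] at hq
    obtain ⟨b, hb, rfl⟩ := hq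
    rw [outerCount]
    congr 1
    ext d
    simp only [Set.mem_ofPred_eq, blockDart_eq_iff]
    tauto
  · intro d hd
    rw [← Finset.mem_coe, hB]
    exact mem_blockSets (.inr hd.2)

lemma sum_interiorCount (B : Finset (Set G.Dart)) (hB : (B : Set (Set G.Dart)) = M.blockSets) :
    {v | M.Interior v}.ncard = ∑ q ∈ B, M.interiorCount q := by
  classical
  -- The block of an interior vertex does not depend on the dart chosen there; the existential
  -- formula makes it a function of the vertex without a choice.
  have key : ∀ v (d : G.Dart), M.Interior v → d.fst = v →
      {e | ∃ d : G.Dart, d.fst = v ∧ M.BlockDart d e} = {e | M.BlockDart d e} := by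
    rintro _ d hv rfl
    ext e
    constructor
    · rintro ⟨d', h1, h2⟩
      exact (blockDart_of_interior hv h1.symm).trans h2
    · exact fun h => ⟨d, rfl, h⟩
  rw [ncard_eq_sum_fiber {v | M.Interior v}
    (fun v => {e | ∃ d : G.Dart, d.fst = v ∧ M.BlockDart d e}) B]
  · refine Finset.sum_congr rfl fun q hq => ?_
    rw [← Finset.mem_coe, hB] at hq
    obtain ⟨b, hb, rfl⟩ := hq
    rw [interiorCount]
    congr 1
    ext v
    simp only [Set.mem_ofPred_eq]
    refine and_congr_right fun hv => ?_
    constructor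
    · intro h
      obtain ⟨d, hd⟩ := hv.1
      rw [key v d hv hd, blockDart_eq_iff] at h
      exact ⟨d, h, hd⟩
    · rintro ⟨d, h1, hd⟩
      rw [key v d hv hd, blockDart_eq_iff]
      exact h1
  · intro v hv
    obtain ⟨d, hd⟩ := hv.1
    rw [← Finset.mem_coe, hB, key v d hv hd]
    exact mem_blockSets (.inl (hv.2 d hd))

lemma three_le_outerCount {q : Set G.Dart} (hq : q ∈ M.blockSets) (h : q ∉ M.closedBlocks) :
    3 ≤ M.outerCount q := by
  have : ∃ d ∈ q, M.Outer d := by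
    by_contra! h'
    exact h ⟨hq, h'⟩
  obtain ⟨b, hb, rfl⟩ := hq
  obtain ⟨d, hd, ho⟩ := this
  exact three_le_ncard_outer hd ho

open Classical in
lemma interiorCount_le {q : Set G.Dart} (hq : q ∈ M.blockSets) :
    6 * M.interiorCount q + 3 * M.outerCount q
      ≤ 6 + (if q ∈ M.closedBlocks then 6 else 0) + M.triCount q := by
  have hq' := hq
  obtain ⟨b, hb, rfl⟩ := hq
  have h1 := block_euler hb
  simp only [closedBlocks, Set.mem_ofPred_eq, hq', true_and]
  exact h1

lemma sum_triDegree [Fintype V] : ∑ v, M.triDegree v = {d | M.Tri d}.ncard := by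
  classical
  rw [ncard_eq_sum_fiber {d | M.Tri d} (fun d => d.fst) Finset.univ (by simp)]
  rfl

lemma sum_outerDegree [Fintype V] : ∑ v, M.outerDegree v = {d | M.Outer d}.ncard := by
  classical
  rw [ncard_eq_sum_fiber {d | M.Outer d} (fun d => d.fst) Finset.univ (by simp)]
  rfl

omit [Finite V] in
open Classical in
lemma sum_interior [Fintype V] :
    ∑ v, (if M.Interior v then 1 else 0) = {v | M.Interior v}.ncard := by
  rw [Set.ncard_eq_toFinset_card', Finset.sum_boole]
  simp

lemma six_mul_interior_add_le :
    6 * {v | M.Interior v}.ncard + 3 * {d | M.Outer d}.ncard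
      ≤ 6 * M.blockSets.ncard + 6 * M.closedBlocks.ncard + {d | M.Tri d}.ncard := by
  classical
  have hB : (M.blockSets.toFinite.toFinset : Set (Set G.Dart)) = M.blockSets :=
    Set.Finite.coe_toFinset _
  rw [sum_triCount _ hB, sum_outerCount _ hB, sum_interiorCount _ hB, Finset.mul_sum,
    Finset.mul_sum, ← Finset.sum_add_distrib]
  refine (Finset.sum_le_sum fun q hq =>
    interiorCount_le (q := q) (by rwa [← Finset.mem_coe, hB] at hq)).trans (le_of_eq ?_)
  rw [Finset.sum_add_distrib, Finset.sum_add_distrib, Finset.sum_const, ← Finset.sum_filter,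
    Finset.sum_const, ← Set.ncard_coe_finset, ← Set.ncard_coe_finset, hB]
  have : ((M.blockSets.toFinite.toFinset.filter fun q => q ∈ M.closedBlocks :
      Finset (Set G.Dart)) : Set (Set G.Dart)) = M.closedBlocks := by
    ext q
    rw [Finset.mem_coe, Finset.mem_filter, Set.Finite.mem_toFinset]
    exact ⟨fun h => h.2, fun h => ⟨h.1, h⟩⟩
  rw [this]
  simp only [smul_eq_mul]
  ring

/-- Blocks with boundary have at least three outer darts; those without have none and are
compensated by the last term. -/
lemma three_mul_blocks_le :
    3 * M.blockSets.ncard ≤ {d | M.Outer d}.ncard + 3 * M.closedBlocks.ncard := by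
  classical
  have hB : (M.blockSets.toFinite.toFinset : Set (Set G.Dart)) = M.blockSets :=
    Set.Finite.coe_toFinset _
  rw [sum_outerCount _ hB]
  have h1 : ∀ q ∈ M.blockSets.toFinite.toFinset,
      3 ≤ M.outerCount q + if q ∈ M.closedBlocks then 3 else 0 := by
    intro q hq
    split_ifs with h
    · omega
    · exact three_le_outerCount (by rwa [← Finset.mem_coe, hB] at hq) h
  have h2 := Finset.sum_le_sum h1
  rw [Finset.sum_add_distrib, Finset.sum_const, ← Finset.sum_filter, Finset.sum_const,
    ← Set.ncard_coe_finset, ← Set.ncard_coe_finset, hB] at h2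
  have : ((M.blockSets.toFinite.toFinset.filter fun q => q ∈ M.closedBlocks :
      Finset (Set G.Dart)) : Set (Set G.Dart)) = M.closedBlocks := by
    ext q
    rw [Finset.mem_coe, Finset.mem_filter, Set.Finite.mem_toFinset]
    exact ⟨fun h => h.2, fun h => ⟨h.1, h⟩⟩
  rw [this] at h2
  simp only [smul_eq_mul] at h2
  omega

lemma five_mul_tri_le (hG : (friendshipGraph 3).Free G) :
    5 * {d | M.Tri d}.ncard
      ≤ 19 * Nat.card V + 6 * {v | M.Interior v}.ncard + {d | M.Outer d}.ncard := by
  classical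
  have := Fintype.ofFinite V
  have h := Finset.sum_le_sum fun v (_ : v ∈ Finset.univ) => five_mul_triDegree_le (M := M) hG v
  rw [← Finset.mul_sum, Finset.sum_add_distrib, Finset.sum_add_distrib, ← Finset.mul_sum,
    sum_interior, sum_triDegree, sum_outerDegree, Finset.sum_const, smul_eq_mul,
    Finset.card_univ, ← Nat.card_eq_fintype_card] at h
  omega

/-- The number of darts on `3`-faces of a graph without three triangles sharing a vertex. -/
lemma four_mul_tri_le (hG : (friendshipGraph 3).Free G) :
    4 * {d | M.Tri d}.ncard ≤ 19 * Nat.card V + 12 * M.closedBlocks.ncard := by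
  -- Eliminating the number of blocks from `h2` by twice `h3` bounds 6I + O by x + 12κ, which is
  -- inserted in `h1`.
  have h1 := five_mul_tri_le (M := M) hG
  have h2 := six_mul_interior_add_le (M := M)
  have h3 := three_mul_blocks_le (M := M)
  omega

end Blocks

end RotationSystem

/-! ### Components, face sizes and the edge bound. -/

namespace RotationSystem

variable {V : Type*} [Finite V] {G : SimpleGraph V} {M : RotationSystem G}

attribute [local instance] finite_dart finite_face

/-- A set of darts closed under reversal and containing with a dart all darts with the same initial
vertex. -/
def IsDartComponent (Z : Set G.Dart) : Prop :=
  (∀ d ∈ Z, d.symm ∈ Z) ∧ ∀ d ∈ Z, ∀ e : G.Dart, d.fst = e.fst → e ∈ Z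

omit [Finite V] in
lemma IsDartComponent.mem_of_reachable {Z : Set G.Dart} (hZ : IsDartComponent Z) {d e : G.Dart}
    (hd : d ∈ Z) (h : G.Reachable d.fst e.fst) : e ∈ Z := by
  have key : ∀ u w : V, G.Walk u w → (∀ e : G.Dart, e.fst = u → e ∈ Z) →
      ∀ e : G.Dart, e.fst = w → e ∈ Z := by
    intro u w p
    induction p with
    | nil => exact id
    | @cons u v w h p ih =>
      intro hu
      refine ih fun e he => ?_
      exact hZ.2 _ (hZ.1 ⟨(u, v), h⟩ (hu _ rfl)) e he.symm
  obtain ⟨p⟩ := h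
  exact key _ _ p (fun e he => hZ.2 d hd e he.symm) e rfl

/-- Isolated vertices and the members of `A` occupy different connected components. This is used for
closed blocks and for faces of size two. -/
lemma isolated_add_le (A : Set (Set G.Dart)) (h₁ : ∀ Z ∈ A, IsDartComponent Z)
    (h₂ : ∀ Z ∈ A, Z.Nonempty) (h₃ : ∀ Z ∈ A, ∀ Z' ∈ A, ∀ d, d ∈ Z → d ∈ Z' → Z = Z') :
    {v : V | ∀ w, ¬ G.Adj v w}.ncard + A.ncard ≤ Nat.card G.ConnectedComponent := by
  classical
  choose g hg using h₂
  have hf : Function.Injective (fun z : {v : V // ∀ w, ¬ G.Adj v w} ⊕ {Z // Z ∈ A} =>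
      z.elim (fun v => G.connectedComponentMk v.1) fun Z => G.connectedComponentMk (g Z.1 Z.2).fst) := by
    have hiso : ∀ v w : V, (∀ w, ¬ G.Adj v w) → G.Reachable v w → v = w := by
      rintro v w hv ⟨p⟩
      cases p with
      | nil => rfl
      | cons h p => exact absurd h (hv _)
    rintro (⟨v, hv⟩ | ⟨Z, hZ⟩) (⟨w, hw⟩ | ⟨Z', hZ'⟩) h
    · exact congrArg Sum.inl (Subtype.ext (hiso v w hv (ConnectedComponent.exact h)))
    · have : v = (g Z' hZ').fst := hiso v _ hv (ConnectedComponent.exact h)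
      exact absurd (g Z' hZ').adj (this ▸ hv _)
    · have : w = (g Z hZ).fst := hiso w _ hw (ConnectedComponent.exact h.symm)
      exact absurd (g Z hZ).adj (this ▸ hw _)
    · have := (h₁ Z hZ).mem_of_reachable (hg Z hZ) (ConnectedComponent.exact h)
      exact congrArg Sum.inr (Subtype.ext (h₃ Z hZ Z' hZ' _ this (hg Z' hZ')))
  have := Nat.card_le_card_of_injective _ hf
  rwa [Nat.card_sum, card_subtype_eq_ncard, card_subtype_eq_ncard, Set.ofPred_mem_eq] at this

lemma isolated_add_one_le (d : G.Dart) :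
    {v : V | ∀ w, ¬ G.Adj v w}.ncard + 1 ≤ Nat.card G.ConnectedComponent := by
  have := isolated_add_le (G := G) {{e | G.Reachable d.fst e.fst}} ?_ ?_ ?_
  · rwa [Set.ncard_singleton] at this
  · rintro _ rfl
    refine ⟨fun e (he : G.Reachable _ _) => ?_, fun e (he : G.Reachable _ _) e' h => ?_⟩
    · exact he.trans e.adj.reachable
    · change G.Reachable _ _
      rwa [← h]
  · rintro _ rfl
    exact ⟨d, Reachable.refl _⟩
  · rintro _ rfl _ rfl _ _ _
    rfl

/-- Without outer darts all darts of the block are on 3-faces, so the rotation never leaves the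
block. -/
lemma isDartComponent_closedBlock {q : Set G.Dart} (hq : q ∈ M.closedBlocks) :
    IsDartComponent q ∧ ∀ d ∈ q, M.Tri d := by
  obtain ⟨⟨b, hb, rfl⟩, ho⟩ := hq
  have ht : ∀ d, M.BlockDart b d → M.Tri d := by
    intro d hd
    by_contra h
    exact ho d hd ⟨h, (hd.tri_or hb).resolve_left h⟩
  refine ⟨⟨fun d hd => hd.reverse, ?_⟩, ht⟩
  rintro d hd e he
  obtain ⟨i, -, rfl⟩ := M.exists_next_iterate he
  clear he
  change M.BlockDart b _
  induction i with
  | zero => exact hd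
  | succ i ih =>
    rw [Function.iterate_succ_apply', blockDart_next_iff]
    · exact ih
    · rw [tri_next]
      exact ht _ ih.reverse

lemma isolated_add_closedBlocks_le :
    {v : V | ∀ w, ¬ G.Adj v w}.ncard + M.closedBlocks.ncard ≤ Nat.card G.ConnectedComponent := by
  refine isolated_add_le _ (fun Z hZ => (isDartComponent_closedBlock hZ).1) ?_ ?_
  · rintro _ ⟨⟨b, hb, rfl⟩, -⟩
    exact ⟨b, .base⟩
  · rintro _ ⟨⟨b, hb, rfl⟩, -⟩ _ ⟨⟨b', hb', rfl⟩, -⟩ d h h'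
    exact (blockDart_eq_iff.2 h).symm.trans (blockDart_eq_iff.2 h')

/-- The boundary of such a face is an edge traversed back and forth, and the rotation fixes both of
its darts: the component is a single edge. -/
lemma isDartComponent_face {f : M.Face} (hf : M.size f = 2) :
    IsDartComponent {d | M.face d = f} := by
  have h1 : ∀ d : G.Dart, M.face d = f → M.facePerm d = d.symm := fun d hd =>
    M.facePerm_eq_symm_of_size_two (hd ▸ hf)
  have h2 : ∀ d : G.Dart, M.face d = f → M.face d.symm = f := fun d hd => by
    rw [← h1 d hd, face_facePerm, hd]
  refine ⟨h2, ?_⟩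
  rintro d hd e he
  obtain ⟨i, -, rfl⟩ := M.exists_next_iterate he
  clear he
  change M.face _ = f
  induction i with
  | zero => exact hd
  | succ i ih =>
    have := h1 _ (h2 _ ih)
    rw [facePerm_apply, Dart.symm_symm] at this
    rw [Function.iterate_succ_apply', this]
    exact ih

lemma isolated_add_size_two_le :
    {v : V | ∀ w, ¬ G.Adj v w}.ncard + {f | M.size f = 2}.ncard
      ≤ Nat.card G.ConnectedComponent := by
  have hinj : Function.Injective fun f : M.Face => {d | M.face d = f} := by
    intro f f' h
    obtain ⟨d, rfl⟩ := M.face_surjective f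
    have : d ∈ {e | M.face e = M.face d} := rfl
    rw [show {e | M.face e = M.face d} = {e | M.face e = f'} from h] at this
    exact this
  rw [← Set.ncard_image_of_injective _ hinj]
  refine isolated_add_le _ ?_ ?_ ?_
  · rintro _ ⟨f, hf, rfl⟩
    exact isDartComponent_face hf
  · rintro _ ⟨f, hf, rfl⟩
    exact M.face_surjective f
  · rintro _ ⟨f, -, rfl⟩ _ ⟨f', -, rfl⟩ d h h'
    have h : M.face d = f := h
    have h' : M.face d = f' := h'
    rw [← h, ← h']

omit [Finite V] in
lemma IsDartComponent.eq_univ (hc : G.Connected) {Z : Set G.Dart} (hZ : IsDartComponent Z)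
    {d : G.Dart} (hd : d ∈ Z) : Z = Set.univ :=
  Set.eq_univ_of_forall fun _ => hZ.mem_of_reachable hd (hc.preconnected _ _)

lemma two_mul_ncard_edgeSet : 2 * G.edgeSet.ncard = Nat.card G.Dart := by
  classical
  have := Fintype.ofFinite V
  rw [Nat.card_eq_fintype_card, dart_card_eq_twice_card_edges, ← coe_edgeFinset,
    Set.ncard_coe_finset]

section FaceCount

variable (M)

lemma sum_size [Fintype M.Face] : ∑ f, M.size f = Nat.card G.Dart := by
  classical
  rw [← Set.ncard_univ, ncard_eq_sum_fiber Set.univ M.face Finset.univ (by simp)]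
  refine Finset.sum_congr rfl fun f _ => ?_
  simp [size]

lemma two_le_size (f : M.Face) : 2 ≤ M.size f := by
  obtain ⟨d, rfl⟩ := M.face_surjective f
  have := M.size_face_pos d
  have := M.size_face_ne_one d
  omega

lemma three_mul_triFaces : 3 * {f | M.size f = 3}.ncard = {d | M.Tri d}.ncard :=
  (ncard_dart_of_faces {f | M.size f = 3} 3 fun _ h => h).symm

/-- Sum over the faces of 4 ≤ size + correction, where the correction is 1 for size 3 and 2 for size
2; there is slack exactly at sizes above 4. -/
lemma four_mul_card_face_le :
    4 * Nat.card M.Face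
        ≤ 2 * G.edgeSet.ncard + {f | M.size f = 3}.ncard + 2 * {f | M.size f = 2}.ncard ∧
    (4 * Nat.card M.Face
        = 2 * G.edgeSet.ncard + {f | M.size f = 3}.ncard + 2 * {f | M.size f = 2}.ncard ↔
      ∀ f, M.size f ≤ 4) := by
  classical
  have := Fintype.ofFinite M.Face
  have h1 : ∀ f ∈ Finset.univ, 4 ≤ M.size f + (if M.size f = 3 then 1 else 0)
      + 2 * (if M.size f = 2 then 1 else 0) := by
    intro f _
    have := M.two_le_size f
    split_ifs <;> omega
  have hsum : ∑ f, (M.size f + (if M.size f = 3 then 1 else 0)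
      + 2 * (if M.size f = 2 then 1 else 0)) = 2 * G.edgeSet.ncard + {f | M.size f = 3}.ncard
        + 2 * {f | M.size f = 2}.ncard := by
    rw [two_mul_ncard_edgeSet, Finset.sum_add_distrib, Finset.sum_add_distrib, sum_size,
      ← Finset.mul_sum, Finset.sum_boole, Finset.sum_boole, Set.ncard_eq_toFinset_card',
      Set.ncard_eq_toFinset_card']
    simp
  have hconst : ∑ _f : M.Face, 4 = 4 * Nat.card M.Face := by
    rw [Finset.sum_const, Finset.card_univ, Nat.card_eq_fintype_card, smul_eq_mul, mul_comm]
  rw [← hsum, ← hconst]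
  refine ⟨Finset.sum_le_sum h1, ?_⟩
  rw [Finset.sum_eq_sum_iff_of_le h1]
  refine ⟨fun h f => ?_, fun h f _ => ?_⟩
  · have := h f (Finset.mem_univ f)
    split_ifs at this <;> omega
  · have := M.two_le_size f
    have := h f
    split_ifs <;> omega

end FaceCount

omit [Finite V] in
lemma connected_of_card_eq_one (h : Nat.card G.ConnectedComponent = 1) : G.Connected := by
  obtain ⟨h1, h2⟩ := Nat.card_eq_one_iff_unique.1 h
  have : Nonempty V := h2.elim fun c => c.ind fun v => ⟨v⟩
  exact ⟨fun u v => ConnectedComponent.exact (Subsingleton.elim _ _)⟩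

omit [Finite V] in
lemma card_connectedComponent_of_connected (h : G.Connected) :
    Nat.card G.ConnectedComponent = 1 := by
  obtain ⟨v⟩ := h.nonempty
  refine Nat.card_eq_one_iff_unique.2 ⟨⟨fun a b => ?_⟩, ⟨G.connectedComponentMk v⟩⟩
  induction a using ConnectedComponent.ind with | _ a =>
  induction b using ConnectedComponent.ind with | _ b =>
  exact ConnectedComponent.sound (h.preconnected a b)

lemma size_two_of_connected (hc : G.Connected) (he : 2 ≤ G.edgeSet.ncard) (f : M.Face) :
    M.size f ≠ 2 := by
  intro hf
  obtain ⟨d, hd⟩ := M.face_surjective f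
  have h1 := (isDartComponent_face hf).eq_univ hc (d := d) hd
  have h2 : M.size f = Nat.card G.Dart := by rw [size, h1, Set.ncard_univ]
  rw [← two_mul_ncard_edgeSet, hf] at h2
  omega

/-- A closed block would be all of G, with every vertex interior. Then 6n ≤ 12 + x by Euler while x
≤ 5n, so n ≤ 12. -/
lemma closedBlocks_of_connected (hG : (friendshipGraph 3).Free G) (hc : G.Connected)
    (hn : 13 ≤ Nat.card V) : M.closedBlocks = ∅ := by
  rw [Set.eq_empty_iff_forall_notMem]
  intro q hq
  have hq' := hq.1
  obtain ⟨hcomp, htri⟩ := isDartComponent_closedBlock hq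
  have hne : q.Nonempty := by
    obtain ⟨b, hb, rfl⟩ := hq'
    exact ⟨b, .base⟩
  obtain ⟨b, hb⟩ := hne
  have huniv := hcomp.eq_univ hc hb
  have h1 := interiorCount_le hq'
  rw [if_pos hq] at h1
  have : Nontrivial V := Finite.one_lt_card_iff_nontrivial.1 (by omega)
  have hI : M.interiorCount q = Nat.card V := by
    rw [interiorCount, ← Set.ncard_univ]
    congr 1
    refine Set.eq_univ_of_forall fun v => ?_
    obtain ⟨w, hw⟩ := hc.preconnected.exists_adj_of_nontrivial v
    have hv : ∃ d : G.Dart, d.fst = v := ⟨⟨(v, w), hw⟩, rfl⟩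
    refine ⟨⟨hv, fun d _ => htri d (huniv ▸ trivial)⟩, ?_⟩
    obtain ⟨d, hd⟩ := hv
    exact ⟨d, huniv ▸ trivial, hd⟩
  have hT : M.triCount q ≤ 5 * Nat.card V := by
    have := Fintype.ofFinite V
    have h2 := Finset.sum_le_sum fun v (_ : v ∈ Finset.univ) => triDegree_le_five (M := M) hG v
    rw [sum_triDegree, Finset.sum_const, Finset.card_univ, ← Nat.card_eq_fintype_card,
      smul_eq_mul] at h2
    refine (Set.ncard_le_ncard fun d hd => hd.2).trans (h2.trans (le_of_eq (mul_comm _ _)))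
  omega

/-- Edge bound for plane graphs without three triangles sharing a vertex. -/
lemma edge_bound (hM : M.IsPlane) (hG : (friendshipGraph 3).Free G) (hn : 13 ≤ Nat.card V) :
    24 * G.edgeSet.ncard + 96 ≤ 67 * Nat.card V ∧
    (24 * G.edgeSet.ncard + 96 = 67 * Nat.card V →
      G.Connected ∧ (∀ f, M.size f = 3 ∨ M.size f = 4) ∧ M.closedBlocks = ∅ ∧
      4 * {d | M.Tri d}.ncard = 19 * Nat.card V) := by
  obtain ⟨h4, h4'⟩ := M.four_mul_card_face_le
  have hx := four_mul_tri_le (M := M) hG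
  have h3 := M.three_mul_triFaces
  have hκ := isolated_add_closedBlocks_le (M := M)
  have hf2 := isolated_add_size_two_le (M := M)
  unfold IsPlane at hM
  rcases Nat.lt_or_ge G.edgeSet.ncard 2 with he | he
  · omega
  have hd : Nonempty G.Dart := by
    by_contra h
    rw [not_nonempty_iff] at h
    have := two_mul_ncard_edgeSet (G := G)
    rw [Nat.card_of_isEmpty] at this
    omega
  obtain ⟨d⟩ := hd
  have hiso := isolated_add_one_le d
  rcases Nat.lt_or_ge 1 (Nat.card G.ConnectedComponent) with hc | hc
  -- With c components, i isolated vertices, κ closed blocks and t faces of size two, the surplus 4i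
  -- + κ + 2t is at most 4c - 1, by adding `hκ`, twice `hf2` and `hiso`. Euler's formula contributes
  -- -8c, so c ≥ 2 leaves a strict inequality.
  · omega
  · have hc' : G.Connected := connected_of_card_eq_one (by omega)
    have hκ0 := closedBlocks_of_connected (M := M) hG hc' hn
    have hf20 : {f | M.size f = 2} = ∅ := by
      rw [Set.eq_empty_iff_forall_notMem]
      exact fun f => size_two_of_connected hc' he f
    rw [hκ0, Set.ncard_empty] at hx
    rw [hf20, Set.ncard_empty] at h4 h4'
    refine ⟨by omega, fun heq => ⟨hc', fun f => ?_, hκ0, by omega⟩⟩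
    have h5 := h4'.1 (by omega) f
    have h6 := size_two_of_connected hc' he f
    have h7 := M.two_le_size f
    omega

end RotationSystem

/-! ### Recognising the icosahedron. -/

/-- The neighbours of a vertex of the icosahedron in cyclic order. -/
def icoNeighbor : Bool × Option (ZMod 5) → ZMod 5 → Bool × Option (ZMod 5)
  | (true, none), k => (true, some k)
  | (false, none), k => (false, some (-k))
  | (true, some _), 0 => (true, none)
  | (true, some i), 1 => (true, some (i - 1))
  | (true, some i), 2 => (false, some i)
  | (true, some i), 3 => (false, some (i + 1))
  | (true, some i), 4 => (true, some (i + 1))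
  | (false, some i), 0 => (true, some i)
  | (false, some i), 1 => (true, some (i - 1))
  | (false, some i), 2 => (false, some (i - 1))
  | (false, some _), 3 => (false, none)
  | (false, some i), 4 => (false, some (i + 1))

set_option synthInstance.maxHeartbeats 400000 in
set_option synthInstance.maxSize 4000 in
lemma icosahedron_adj_iff (v w : Bool × Option (ZMod 5)) :
    icosahedron.Adj v w ↔ ∃ k, icoNeighbor v k = w := by
  simp only [icosahedron, fromRel_adj]
  revert v w
  decide +kernel

/-- Characterization of the icosahedron among maps in which all vertices have degree `5` and all
faces are triangles: `σ` is the rotation, `ρ` the reversal of darts and `s` the initial vertex. -/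
lemma exists_icosahedron_labelling {D V : Type*} [Nonempty D] (σ ρ : D → D) (s : D → V)
    (hρ : ∀ d, ρ (ρ d) = d) (hσ : ∀ d, σ (σ (σ (σ (σ d)))) = d)
    (h3 : ∀ d, σ (ρ (σ (ρ (σ (ρ d))))) = d) (hs : ∀ d, s (σ d) = s d)
    (ht : ∀ d e, s d = s e → ∃ k < 5, σ^[k] d = e)
    (hc : ∀ Y : Set D, Y.Nonempty → (∀ d ∈ Y, σ d ∈ Y) → (∀ d ∈ Y, ρ d ∈ Y) → ∀ d, d ∈ Y)
    (hV : (Set.range s).ncard = 12) :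
    ∃ F : Bool × Option (ZMod 5) → V, Function.Injective F ∧ Set.range F = Set.range s ∧
      ∀ v y, (∃ d, s d = F v ∧ s (ρ d) = y) ↔ ∃ w, icosahedron.Adj v w ∧ F w = y := by
  obtain ⟨d₀⟩ := ‹Nonempty D›
  -- The triangle relation, solved for the reversal: it carries darts from one vertex to the next.
  have R : ∀ e, σ (ρ (σ (ρ (σ e)))) = ρ e := fun e => by simpa [hρ] using h3 (ρ e)
  have σinv : ∀ d e, σ d = e → d = σ (σ (σ (σ e))) := by rintro d _ rfl; rw [hσ]
  -- The darts `a i` leave a pole, `u i` points from the first ring back to it, `x i` from the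
  -- second ring up to the first, and `y i` from the opposite pole to the second ring. The relations
  -- below close both rings and show that all `y i` start at one vertex.
  let a : ZMod 5 → D := fun i => σ^[i.val] d₀
  have ha : ∀ i, σ (a i) = a (i + 1) := by
    intro i
    change ZMod 5 at i
    fin_cases i
    · rfl
    · rfl
    · rfl
    · rfl
    · exact hσ d₀
  let u : ZMod 5 → D := fun i => ρ (a i)
  have hu : ∀ i, σ (ρ (σ (u (i + 1)))) = u i := fun i => by
    simp only [u]; rw [← ha, R]
  have hu' : ∀ i, ρ (σ (u (i + 1))) = σ (σ (σ (σ (u i)))) := fun i => σinv _ _ (hu i)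
  have hu4 : ∀ i, ρ (σ (σ (σ (σ (u i))))) = σ (u (i + 1)) := fun i => by rw [← hu', hρ]
  let x : ZMod 5 → D := fun i => ρ (σ (σ (u i)))
  have hx1 : ∀ i, σ (x (i + 1)) = ρ (σ (σ (σ (u i)))) := fun i => by
    simp only [x]; rw [← R (σ (σ (σ (u i)))), hu4]
  have hx2 : ∀ i, σ (ρ (σ (σ (x (i + 1))))) = x i := fun i => by
    rw [hx1, R]
  have hx2' : ∀ i, ρ (σ (σ (x (i + 1)))) = σ (σ (σ (σ (x i)))) := fun i => σinv _ _ (hx2 i)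
  have hx4 : ∀ i, ρ (σ (σ (σ (σ (x i))))) = σ (σ (x (i + 1))) := fun i => by rw [← hx2', hρ]
  let y : ZMod 5 → D := fun i => ρ (σ (σ (σ (x i))))
  have hy : ∀ i, σ (y (i + 1)) = y i := fun i => by
    simp only [y]; rw [← R (σ (σ (σ (x i)))), hx4]
  have hyQ : ∀ i, s (y i) = s (y 0) := by
    have h1 : ∀ i, s (y (i + 1)) = s (y i) := fun i => by rw [← hy i, hs]
    have h2 : ∀ k : ℕ, s (y k) = s (y 0) := by
      intro k
      induction k with
      | zero => simp
      | succ k ih => rw [Nat.cast_succ, h1, ih]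
    intro i
    rw [← ZMod.natCast_zmod_val i, h2]
  let g : Bool × Option (ZMod 5) → D := fun
    | (true, none) => a 0
    | (true, some i) => u i
    | (false, some i) => x i
    | (false, none) => y 0
  let F : Bool × Option (ZMod 5) → V := fun v => s (g v)
  have hsub : ∀ i : ZMod 5, i = (i - 1) + 1 := fun i => by ring
  have key : ∀ (v : Bool × Option (ZMod 5)) (k : ZMod 5),
      s (ρ (σ^[k.val] (g v))) = F (icoNeighbor v k) := by
    rintro ⟨b, i⟩ k
    cases b <;> rcases i with _ | i
    · have h1 : ∀ k : ℕ, σ^[k] (y 0) = y (-k) := by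
        intro k
        induction k with
        | zero => simp
        | succ k ih =>
          rw [Function.iterate_succ_apply', ih, ← hy (-(k + 1 : ℕ))]
          congr 2; push_cast; ring
      change s (ρ (σ^[k.val] (y 0))) = s (x (-k))
      rw [h1, ZMod.natCast_zmod_val]
      simp only [y]
      rw [hρ, hs, hs, hs]
    · change ZMod 5 at k
      fin_cases k
      · change s (ρ (x i)) = s (u i)
        simp only [x]
        rw [hρ, hs, hs]
      · change s (ρ (σ (x i))) = s (u (i - 1))
        rw [hsub i, hx1, hρ, hs, hs, hs, ← hsub]
      · change s (ρ (σ (σ (x i)))) = s (x (i - 1))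
        rw [hsub i, hx2', hs, hs, hs, hs, ← hsub]
      · exact hyQ i
      · change s (ρ (σ (σ (σ (σ (x i)))))) = s (x (i + 1))
        rw [hx4, hs, hs]
    · change s (ρ (a k)) = s (u k)
      rfl
    · change ZMod 5 at k
      fin_cases k
      · change s (ρ (u i)) = s (a 0)
        simp only [u]
        rw [hρ]
        simp only [a]
        have h1 : ∀ k : ℕ, s (σ^[k] d₀) = s d₀ := by
          intro k
          induction k with
          | zero => rfl
          | succ k ih => rw [Function.iterate_succ_apply', hs, ih]
        rw [h1, h1]
      · change s (ρ (σ (u i))) = s (u (i - 1))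
        rw [hsub i, hu', hs, hs, hs, hs, ← hsub]
      · rfl
      · change s (ρ (σ (σ (σ (u i))))) = s (x (i + 1))
        rw [← hx1, hs]
      · change s (ρ (σ (σ (σ (σ (u i)))))) = s (u (i + 1))
        rw [hu4, hs]
  have hFs : ∀ v, F v = s (g v) := fun _ => rfl
  have hout : ∀ v d, s d = F v → ∃ w, icosahedron.Adj v w ∧ F w = s (ρ d) := by
    intro v d hd
    obtain ⟨k, hk, rfl⟩ := ht (g v) d hd.symm
    refine ⟨icoNeighbor v k, (icosahedron_adj_iff _ _).2 ⟨k, rfl⟩, ?_⟩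
    rw [← key, ZMod.val_natCast_of_lt hk]
  have hrange : Set.range F = Set.range s := by
    apply Set.Subset.antisymm
    · rintro _ ⟨v, rfl⟩
      exact ⟨g v, rfl⟩
    · rintro _ ⟨d, rfl⟩
      refine hc {d | s d ∈ Set.range F} ⟨d₀, (true, none), rfl⟩ ?_ ?_ d
      · intro d hd
        rw [Set.mem_ofPred_eq, hs]; exact hd
      · rintro d ⟨v, hv⟩
        obtain ⟨w, -, hw⟩ := hout v d hv.symm
        exact ⟨w, hw⟩
  refine ⟨F, ?_, hrange, ?_⟩
  -- The labelling maps 12 labels onto the 12 vertices, hence is injective.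
  · classical
    rw [← hrange, ← Set.image_univ, ← Finset.coe_univ, ← Finset.coe_image,
      Set.ncard_coe_finset] at hV
    have h1 : (Finset.univ.image F).card = (Finset.univ : Finset (Bool × Option (ZMod 5))).card := by
      rw [hV]; rfl
    rw [Finset.card_image_iff, Finset.coe_univ] at h1
    exact Set.injOn_univ.1 h1
  · intro v z
    constructor
    · rintro ⟨d, hd, rfl⟩
      exact hout v d hd
    · rintro ⟨w, hw, rfl⟩
      obtain ⟨k, rfl⟩ := (icosahedron_adj_iff _ _).1 hw
      refine ⟨σ^[k.val] (g v), ?_, key v k⟩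
      have h1 : ∀ k : ℕ, s (σ^[k] (g v)) = s (g v) := by
        intro k
        induction k with
        | zero => rfl
        | succ k ih => rw [Function.iterate_succ_apply', hs, ih]
      exact h1 _

/-! ### Structure of the extremal graphs. -/

namespace RotationSystem

variable {V : Type*} [Finite V] {G : SimpleGraph V} {M : RotationSystem G}

attribute [local instance] finite_dart finite_face

/-- At every vertex there are as many `3`-faces as possible for a graph without three triangles
sharing a vertex, and the boundary vertices have a single run of `3`-faces. -/
def IsTight (M : RotationSystem G) : Prop :=
  ∀ v, (M.Interior v → M.triDegree v = 5) ∧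
    (¬ M.Interior v → M.triDegree v = 4 ∧ M.outerDegree v = 1)

/-- The hypothesis makes all three summed estimates equalities, hence so is each term. At a boundary
vertex 5t = 19 + o with t ≤ 4 leaves only t = 4 and o = 1. -/
lemma tight_of_extremal (hG : (friendshipGraph 3).Free G) (hκ : M.closedBlocks = ∅)
    (hx : 4 * {d | M.Tri d}.ncard = 19 * Nat.card V) :
    M.IsTight ∧ (∀ q ∈ M.blockSets, M.outerCount q = 3) ∧
      {d | M.Tri d}.ncard = 6 * {v | M.Interior v}.ncard + {d | M.Outer d}.ncard := by
  classical
  have := Fintype.ofFinite V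
  have h1 := five_mul_tri_le (M := M) hG
  have h2 := six_mul_interior_add_le (M := M)
  have h3 := three_mul_blocks_le (M := M)
  rw [hκ, Set.ncard_empty] at h2 h3
  refine ⟨?_, ?_, by omega⟩
  · have hle := fun v (_ : v ∈ Finset.univ) => five_mul_triDegree_le (M := M) hG v
    have hsum : ∑ v, 5 * M.triDegree v
        = ∑ v, (19 + 6 * (if M.Interior v then 1 else 0) + M.outerDegree v) := by
      rw [← Finset.mul_sum, Finset.sum_add_distrib, Finset.sum_add_distrib, ← Finset.mul_sum,
        sum_interior, sum_triDegree, sum_outerDegree, Finset.sum_const, smul_eq_mul,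
        Finset.card_univ, ← Nat.card_eq_fintype_card]
      omega
    rw [Finset.sum_eq_sum_iff_of_le hle] at hsum
    intro v
    have hv := hsum v (Finset.mem_univ v)
    refine ⟨fun hi => ?_, fun hi => ?_⟩
    · have h5 := triDegree_le_five (M := M) hG v
      rw [if_pos hi] at hv
      omega
    · have h5 := triDegree_le_four hG hi
      rw [if_neg hi] at hv
      omega
  · have hB : (M.blockSets.toFinite.toFinset : Set (Set G.Dart)) = M.blockSets :=
      Set.Finite.coe_toFinset _
    have hle : ∀ q ∈ M.blockSets.toFinite.toFinset, 3 ≤ M.outerCount q := fun q hq =>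
      three_le_outerCount (by rwa [← Finset.mem_coe, hB] at hq) (by simp [hκ])
    have hsum : ∑ q ∈ M.blockSets.toFinite.toFinset, 3
        = ∑ q ∈ M.blockSets.toFinite.toFinset, M.outerCount q := by
      rw [← sum_outerCount _ hB, Finset.sum_const, smul_eq_mul, ← Set.ncard_coe_finset, hB]
      omega
    rw [Finset.sum_eq_sum_iff_of_le hle] at hsum
    intro q hq
    exact (hsum q (by rwa [← Finset.mem_coe, hB])).symm

omit [Finite V] in
lemma IsTight.outer_unique (hM : M.IsTight) {d e : G.Dart} (hd : M.Outer d) (he : M.Outer e)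
    (h : d.fst = e.fst) : d = e := by
  have h1 := ((hM e.fst).2 he.not_interior).2
  obtain ⟨a, ha⟩ := Set.ncard_eq_one.1 h1
  have hd' : d ∈ {d | M.Outer d ∧ d.fst = e.fst} := ⟨hd, h⟩
  have he' : e ∈ {d | M.Outer d ∧ d.fst = e.fst} := ⟨he, rfl⟩
  rw [ha] at hd' he'
  rw [show d = a from hd', show e = a from he']

lemma IsTight.start_eq (hM : M.IsTight) {s d : G.Dart} (hs : M.Outer s) (h : s.fst = d.fst)
    (hd : M.Tri d ∨ M.Tri d.symm) : M.start d = s :=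
  hM.outer_unique (outer_start (h ▸ hs.not_interior) hd) hs (by simp [h])

/-- Around a boundary vertex there is a run of exactly four `3`-faces. -/
lemma IsTight.run (hM : M.IsTight) {s : G.Dart} (hs : M.Outer s) :
    (∀ j, 1 ≤ j → j ≤ 4 → M.Tri (M.next^[j] s)) ∧ ¬ M.Tri (M.next^[5] s) := by
  classical
  have hex : ∃ j, 1 ≤ j ∧ ¬ M.Tri (M.next^[j] s) := by
    refine ⟨Function.minimalPeriod M.next s, minimalPeriod_perm_pos _ _, ?_⟩
    rw [Function.iterate_minimalPeriod]
    exact hs.1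
  obtain ⟨h1, hnt⟩ := Nat.find_spec hex
  have hlt : ∀ j, 1 ≤ j → j < Nat.find hex → M.Tri (M.next^[j] s) := by
    intro j hj hj'
    by_contra h
    exact Nat.find_min hex hj' ⟨hj, h⟩
  have hper : Nat.find hex ≤ Function.minimalPeriod M.next s := by
    refine Nat.find_min' hex ⟨minimalPeriod_perm_pos _ _, ?_⟩
    rw [Function.iterate_minimalPeriod]
    exact hs.1
  -- The outer dart at the vertex being unique, every dart there on a 3-face has start `s`; so this
  -- single run contains all four of them.
  have hT : {d | M.Tri d ∧ d.fst = s.fst}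
      = (fun j => M.next^[j] s) '' (Finset.Ico 1 (Nat.find hex) : Set ℕ) := by
    ext d
    constructor
    · rintro ⟨hd, hds⟩
      have hst := hM.start_eq hs hds.symm (.inl hd)
      obtain ⟨k, hk, -, hkt⟩ := exists_start_spec (hds ▸ hs.not_interior)
      rw [hst] at hk hkt
      refine ⟨k, ?_, hk⟩
      rw [Finset.coe_Ico, Set.mem_Ico]
      constructor
      · rw [Nat.one_le_iff_ne_zero]
        rintro rfl
        rw [Function.iterate_zero, id] at hk
        exact hs.1 (hk ▸ hd)
      · by_contra! h
        exact hnt (hkt _ h1 h)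
    · rintro ⟨j, hj, rfl⟩
      rw [Finset.coe_Ico, Set.mem_Ico] at hj
      exact ⟨hlt j hj.1 hj.2, by simp⟩
  have hcard : {d | M.Tri d ∧ d.fst = s.fst}.ncard = Nat.find hex - 1 := by
    rw [hT, Set.InjOn.ncard_image, Set.ncard_coe_finset, Nat.card_Ico]
    refine Function.iterate_injOn_Iio_minimalPeriod.mono ?_
    intro j hj
    rw [Finset.coe_Ico, Set.mem_Ico] at hj
    exact Set.mem_Iio.2 (by omega)
  have h4 := ((hM s.fst).2 hs.not_interior).1
  rw [triDegree, hcard] at h4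
  have h5 : Nat.find hex = 5 := by omega
  rw [h5] at hnt hlt
  exact ⟨fun j h h' => hlt j h (by omega), hnt⟩

open Classical in
/-- The rotation around a vertex of a triangular-block with the gap between the ends of a run of
`3`-faces closed. -/
noncomputable def blockNext (M : RotationSystem G) (d : G.Dart) : G.Dart :=
  if M.Tri (M.next d) then M.next d else M.start d

omit [Finite V] in
@[simp] lemma blockNext_fst (d : G.Dart) : (M.blockNext d).fst = d.fst := by
  unfold blockNext; split_ifs <;> simp

/-- All triangular-block darts at a vertex are obtained from one of them by the closed up
rotation, which has order `5`. -/
lemma IsTight.exists_root (hM : M.IsTight) {d : G.Dart} (hd : M.Tri d ∨ M.Tri d.symm) :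
    ∃ s : G.Dart, M.blockNext^[5] s = s ∧ ∀ e : G.Dart, e.fst = d.fst → (M.Tri e ∨ M.Tri e.symm) →
      ∃ k < 5, M.blockNext^[k] s = e := by
  by_cases hi : M.Interior d.fst
  · have h1 : ∀ k, M.blockNext^[k] d = M.next^[k] d := by
      intro k
      induction k with
      | zero => rfl
      | succ k ih =>
        rw [Function.iterate_succ_apply', Function.iterate_succ_apply', ih, blockNext, if_pos]
        exact hi.2 _ (by simp)
    have h2 : Function.minimalPeriod M.next d = 5 := by
      rw [← (hM d.fst).1 hi, triDegree, ← ncard_sameCycle]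
      congr 1
      ext e
      rw [Set.mem_ofPred_eq, Set.mem_ofPred_eq, M.sameCycle_iff]
      exact ⟨fun h => ⟨hi.2 e h.symm, h.symm⟩, fun h => h.2.symm⟩
    refine ⟨d, ?_, fun e he _ => ?_⟩
    · rw [h1, ← h2, Function.iterate_minimalPeriod]
    · obtain ⟨k, hk, hke⟩ := M.exists_next_iterate he.symm
      exact ⟨k, h2 ▸ hk, by rw [h1, hke]⟩
  · have hs := outer_start hi hd
    set s := M.start d with hsd
    have hsf : s.fst = d.fst := by simp [hsd]
    obtain ⟨h4, h5⟩ := hM.run hs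
    have h1 : ∀ k ≤ 4, M.blockNext^[k] s = M.next^[k] s := by
      intro k hk
      induction k with
      | zero => rfl
      | succ k ih =>
        rw [Function.iterate_succ_apply', Function.iterate_succ_apply', ih (by omega), blockNext,
          if_pos]
        rw [← Function.iterate_succ_apply' M.next]
        exact h4 _ (by omega) hk
    refine ⟨s, ?_, fun e he ht => ?_⟩
    · rw [Function.iterate_succ_apply', h1 4 le_rfl, blockNext, if_neg]
      · exact hM.start_eq hs (by simp) (.inl (h4 4 (by omega) le_rfl))
      · rwa [← Function.iterate_succ_apply' M.next]
    · have hst := hM.start_eq hs (hsf.trans he.symm) ht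
      obtain ⟨k, hk, -, hkt⟩ := exists_start_spec (d := e) (he ▸ hi)
      rw [hst] at hk hkt
      have hk4 : k ≤ 4 := by
        by_contra! h
        exact h5 (hkt 5 (by omega) h)
      exact ⟨k, by omega, by rw [h1 k hk4, hk]⟩

lemma IsTight.blockNext_five (hM : M.IsTight) {d : G.Dart} (hd : M.Tri d ∨ M.Tri d.symm) :
    M.blockNext^[5] d = d := by
  obtain ⟨s, h5, hs⟩ := hM.exists_root hd
  obtain ⟨k, -, hk⟩ := hs d rfl hd
  rw [← hk, ← Function.iterate_add_apply, add_comm, Function.iterate_add_apply, h5]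

lemma IsTight.exists_blockNext_iterate (hM : M.IsTight) {d e : G.Dart}
    (hd : M.Tri d ∨ M.Tri d.symm) (he : M.Tri e ∨ M.Tri e.symm) (h : d.fst = e.fst) :
    ∃ k < 5, M.blockNext^[k] d = e := by
  obtain ⟨s, h5, hs⟩ := hM.exists_root hd
  obtain ⟨k, hk, rfl⟩ := hs d rfl hd
  obtain ⟨l, hl, rfl⟩ := hs e h.symm he
  rcases le_or_gt k l with hkl | hkl
  · exact ⟨l - k, by omega, by rw [← Function.iterate_add_apply, Nat.sub_add_cancel hkl]⟩
  · refine ⟨l + 5 - k, by omega, ?_⟩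
    rw [← Function.iterate_add_apply, Nat.sub_add_cancel (by omega), Function.iterate_add_apply, h5]

lemma blockDart_blockNext {b d : G.Dart} (hd : M.BlockDart b d) :
    M.BlockDart b (M.blockNext d) := by
  unfold blockNext
  split_ifs with h
  · exact (blockDart_next_iff h).2 hd
  · refine (blockDart_start_iff fun hi => ?_).2 hd
    exact h (hi.2 _ (by simp))

omit [Finite V] in
lemma blockNext_symm (d : G.Dart) : M.Tri d → M.blockNext d.symm = M.facePerm d := by
  intro h
  rw [blockNext, if_pos, facePerm_apply]
  rwa [tri_next, Dart.symm_symm]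

omit [Finite V] in
lemma blockNext_symm_of_not_tri (d : G.Dart) (h : ¬ M.Tri d) :
    M.blockNext d.symm = M.boundaryNext d := by
  rw [blockNext, if_neg, boundaryNext]
  rwa [tri_next, Dart.symm_symm]

/-- For the closed-up rotation the boundary walk is one more face; having three darts it is a
triangle, like all the others. -/
lemma blockNext_symm_three {b d : G.Dart} (hb : M.Tri b) (hd : M.BlockDart b d)
    (h3 : {d | M.BlockDart b d ∧ M.Outer d}.ncard = 3) :
    M.blockNext (M.blockNext (M.blockNext d.symm).symm).symm = d := by
  by_cases h : M.Tri d
  · have h1 := (M.tri_facePerm _).2 h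
    have h2 := (M.tri_facePerm _).2 h1
    rw [blockNext_symm _ h, blockNext_symm _ h1, blockNext_symm _ h2, h.facePerm_three]
  · have ho : M.Outer d := ⟨h, (hd.tri_or hb).resolve_left h⟩
    rw [blockNext_symm_of_not_tri _ h, blockNext_symm_of_not_tri _ ho.boundaryNext.1,
      blockNext_symm_of_not_tri _ ho.boundaryNext.boundaryNext.1, boundaryNext_three hd ho h3]

/-- Darts on 3-faces are grouped by their initial vertex if it is interior, five to a vertex, and
otherwise by their start, four to an outer dart. -/
lemma IsTight.triCount_eq (hM : M.IsTight) {q : Set G.Dart} (hq : q ∈ M.blockSets) :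
    M.triCount q = 5 * M.interiorCount q + 4 * M.outerCount q := by
  obtain ⟨b, hb, rfl⟩ := hq
  have h1 := ncard_preimage_eq_mul (fun d : {d // M.BlockDart b d ∧ M.Tri d ∧ M.Interior d.fst} =>
    d.1.fst) {v | M.Interior v ∧ ∃ d, M.BlockDart b d ∧ d.fst = v} 5 ?_
  · have h2 := ncard_preimage_eq_mul
      (fun d : {d // M.BlockDart b d ∧ M.Tri d ∧ ¬ M.Interior d.fst} => M.start d.1)
      {d | M.BlockDart b d ∧ M.Outer d} 4 ?_
    · have e1 : M.interiorCount {d | M.BlockDart b d}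
        = {v | M.Interior v ∧ ∃ d, M.BlockDart b d ∧ d.fst = v}.ncard := rfl
      have e2 : M.outerCount {d | M.BlockDart b d}
        = {d | M.BlockDart b d ∧ M.Outer d}.ncard := rfl
      rw [e1, e2, ← h1, ← h2, ← Set.ncard_image_of_injective _ Subtype.val_injective,
        ← Set.ncard_image_of_injective (α := {d // M.BlockDart b d ∧ M.Tri d ∧ ¬ M.Interior d.fst})
          _ Subtype.val_injective,
        ← Set.ncard_union_eq]
      · rw [triCount]
        congr 1
        ext d
        constructor
        · rintro ⟨hd, ht⟩
          by_cases hi : M.Interior d.fst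
          · exact .inl ⟨⟨d, hd, ht, hi⟩, ⟨hi, d, hd, rfl⟩, rfl⟩
          · exact .inr ⟨⟨d, hd, ht, hi⟩, ⟨(blockDart_start_iff hi).2 hd,
              outer_start hi (.inl ht)⟩, rfl⟩
        · rintro (⟨⟨d, h⟩, -, rfl⟩ | ⟨⟨d, h⟩, -, rfl⟩)
          · exact ⟨h.1, h.2.1⟩
          · exact ⟨h.1, h.2.1⟩
      · rw [Set.disjoint_left]
        rintro _ ⟨⟨d, h⟩, -, rfl⟩ ⟨⟨d', h'⟩, -, rfl⟩
        exact h'.2.2 h.2.2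
    · rintro s ⟨hs, ho⟩
      rw [← ((hM s.fst).2 ho.not_interior).1, triDegree,
        ← Set.ncard_image_of_injective _ Subtype.val_injective]
      congr 1
      ext d
      constructor
      · rintro ⟨⟨d, h⟩, hd, rfl⟩
        refine ⟨h.2.1, ?_⟩
        rw [← show M.start d = s from hd, start_fst]
      · rintro ⟨ht, hd⟩
        have hi : ¬ M.Interior d.fst := hd ▸ ho.not_interior
        have hst := hM.start_eq ho hd.symm (.inl ht)
        exact ⟨⟨d, (blockDart_start_iff hi).1 (hst ▸ hs), ht, hi⟩, hst, rfl⟩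
  · rintro v ⟨hv, d, hd, rfl⟩
    rw [← (hM d.fst).1 hv, triDegree, ← Set.ncard_image_of_injective _ Subtype.val_injective]
    congr 1
    ext e
    constructor
    · rintro ⟨⟨e, h⟩, he, rfl⟩
      exact ⟨h.2.1, he⟩
    · rintro ⟨ht, he⟩
      exact ⟨⟨e, hd.trans (blockDart_of_interior hv he.symm), ht, he ▸ hv⟩, he, rfl⟩

/-- With three outer darts and i interior vertices, Euler's inequality is 6i + 9 ≤ 6 + 5i + 12, so i
≤ 9. The global identity `hx` says that the average of i is 9. -/
lemma IsTight.interiorCount_eq (hM : M.IsTight) (hκ : M.closedBlocks = ∅)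
    (h3 : ∀ q ∈ M.blockSets, M.outerCount q = 3)
    (hx : {d | M.Tri d}.ncard = 6 * {v | M.Interior v}.ncard + {d | M.Outer d}.ncard) :
    ∀ q ∈ M.blockSets, M.interiorCount q = 9 := by
  classical
  have hB : (M.blockSets.toFinite.toFinset : Set (Set G.Dart)) = M.blockSets :=
    Set.Finite.coe_toFinset _
  set B := M.blockSets.toFinite.toFinset
  have hmem : ∀ q, q ∈ B ↔ q ∈ M.blockSets := fun q => by rw [← Finset.mem_coe, hB]
  have hle : ∀ q ∈ B, M.interiorCount q ≤ 9 := by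
    intro q hq
    rw [hmem] at hq
    have h1 := interiorCount_le hq
    rw [hM.triCount_eq hq, h3 q hq, if_neg (by simp [hκ])] at h1
    omega
  have h1 : ∑ q ∈ B, M.triCount q = 5 * ∑ q ∈ B, M.interiorCount q + B.card * 12 := by
    rw [Finset.mul_sum, ← smul_eq_mul, ← Finset.sum_const, ← Finset.sum_add_distrib]
    refine Finset.sum_congr rfl fun q hq => ?_
    rw [hmem] at hq
    rw [hM.triCount_eq hq, h3 q hq]
  have h2 : ∑ q ∈ B, M.outerCount q = B.card * 3 := by
    rw [← smul_eq_mul, ← Finset.sum_const]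
    exact Finset.sum_congr rfl fun q hq => h3 q ((hmem q).1 hq)
  rw [sum_triCount B hB, sum_interiorCount B hB, sum_outerCount B hB, h1, h2] at hx
  have hsum : ∑ q ∈ B, M.interiorCount q = ∑ q ∈ B, 9 := by
    rw [Finset.sum_const, smul_eq_mul]
    omega
  rw [Finset.sum_eq_sum_iff_of_le hle] at hsum
  exact fun q hq => hsum q ((hmem q).2 hq)

lemma IsTight.ncard_verts (hM : M.IsTight) {b : G.Dart} (hb : M.Tri b)
    (h3 : M.outerCount {d | M.BlockDart b d} = 3) (h9 : M.interiorCount {d | M.BlockDart b d} = 9) :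
    (M.blockFrom b).verts.ncard = 12 := by
  have h1 : (M.blockFrom b).verts = {v | M.Interior v ∧ ∃ d, M.BlockDart b d ∧ d.fst = v}
      ∪ (fun d : G.Dart => d.fst) '' {d | M.BlockDart b d ∧ M.Outer d} := by
    ext v
    constructor
    · rintro ⟨d, hd, rfl⟩
      by_cases hi : M.Interior d.fst
      · exact .inl ⟨hi, d, hd, rfl⟩
      · exact .inr ⟨M.start d, ⟨(blockDart_start_iff hi).2 hd, outer_start hi (hd.tri_or hb)⟩,
          start_fst d⟩
    · rintro (⟨-, d, hd⟩ | ⟨d, hd, rfl⟩)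
      · exact ⟨d, hd⟩
      · exact ⟨d, hd.1, rfl⟩
  have h2 : Disjoint {v | M.Interior v ∧ ∃ d, M.BlockDart b d ∧ d.fst = v}
      ((fun d : G.Dart => d.fst) '' {d | M.BlockDart b d ∧ M.Outer d}) := by
    rw [Set.disjoint_left]
    rintro _ hi ⟨d, hd, rfl⟩
    exact hd.2.not_interior hi.1
  rw [h1, Set.ncard_union_eq h2, Set.InjOn.ncard_image fun d hd e he h =>
    hM.outer_unique hd.2 he.2 h]
  exact congrArg₂ (· + ·) h9 h3

lemma IsTight.block_iso (hM : M.IsTight) {b : G.Dart} (hb : M.Tri b)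
    (h3 : M.outerCount {d | M.BlockDart b d} = 3) (h9 : M.interiorCount {d | M.BlockDart b d} = 9) :
    Nonempty ((M.blockFrom b).coe ≃g icosahedron) := by
  have hne : Nonempty {d // M.BlockDart b d} := ⟨b, .base⟩
  have hσval : ∀ (k : ℕ) (d : {d // M.BlockDart b d}),
      ((fun d : {d // M.BlockDart b d} => (⟨M.blockNext d.1, blockDart_blockNext d.2⟩ :
        {d // M.BlockDart b d}))^[k] d).1 = M.blockNext^[k] d.1 := by
    intro k d
    induction k with
    | zero => rfl
    | succ k ih =>
      rw [Function.iterate_succ_apply', Function.iterate_succ_apply']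
      exact congrArg M.blockNext ih
  have hrange : Set.range (fun d : {d // M.BlockDart b d} => d.1.fst) = (M.blockFrom b).verts := by
    ext v
    exact ⟨fun ⟨d, h⟩ => ⟨d.1, d.2, h⟩, fun ⟨d, hd, h⟩ => ⟨⟨d, hd⟩, h⟩⟩
  obtain ⟨F, hF, hFr, hadj⟩ := exists_icosahedron_labelling
    (fun d : {d // M.BlockDart b d} => ⟨M.blockNext d.1, blockDart_blockNext d.2⟩)
    (fun d => ⟨d.1.symm, d.2.reverse⟩) (fun d => d.1.fst)
    (fun d => Subtype.ext (Dart.symm_symm d.1))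
    (fun d => Subtype.ext (hM.blockNext_five (d.2.tri_or hb)))
    (fun d => Subtype.ext (blockNext_symm_three hb d.2 h3))
    (fun d => blockNext_fst d.1)
    (fun d e h => by
      obtain ⟨k, hk, hke⟩ := hM.exists_blockNext_iterate (d.2.tri_or hb) (e.2.tri_or hb) h
      exact ⟨k, hk, Subtype.ext (by rw [hσval, hke])⟩)
    (by
      rintro Y ⟨⟨e, he⟩, hY⟩ h1 h2 ⟨d, hd⟩
      have key : ∀ d, M.BlockDart e d → ∃ h, (⟨d, h⟩ : {d // M.BlockDart b d}) ∈ Y := by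
        intro d hd
        induction hd with
        | base => exact ⟨he, hY⟩
        | reverse d _ ih =>
          obtain ⟨h, hdY⟩ := ih
          exact ⟨h.reverse, h2 _ hdY⟩
        | grow d _ ht ih =>
          obtain ⟨h, hdY⟩ := ih
          have h4 := h1 _ (h2 _ hdY)
          refine ⟨h.grow d ht, ?_⟩
          convert h4
          exact (blockNext_symm d ht).symm
      exact (key d (he.symm.trans hd)).2)
    (by rw [hrange]; exact hM.ncard_verts hb h3 h9)
  rw [hrange] at hFr
  refine ⟨RelIso.symm ⟨(Equiv.ofInjective F hF).trans (Equiv.setCongr hFr), ?_⟩⟩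
  intro v w
  change (∃ d, M.BlockDart b d ∧ d.fst = F v ∧ d.snd = F w) ↔ icosahedron.Adj v w
  constructor
  · rintro ⟨d, hd, h1, h2⟩
    obtain ⟨w', hw', hFw⟩ := (hadj v (F w)).1 ⟨⟨d, hd⟩, h1, h2⟩
    rwa [← hF hFw]
  · intro h
    obtain ⟨d, h1, h2⟩ := (hadj v (F w)).2 ⟨w, h, rfl⟩
    exact ⟨d.1, d.2, h1, h2⟩

lemma blockFrom_eq {b d : G.Dart} (h : M.BlockDart b d) : M.blockFrom b = M.blockFrom d := by
  have h1 : ∀ e, M.BlockDart b e ↔ M.BlockDart d e :=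
    fun e => ⟨fun h' => h.symm.trans h', fun h' => h.trans h'⟩
  ext u v
  · simp only [blockFrom, h1]
  · simp only [blockFrom, h1]

omit [Finite V] in
lemma blockFrom_adj_iff (b d : G.Dart) : (M.blockFrom b).Adj d.fst d.snd ↔ M.BlockDart b d := by
  constructor
  · rintro ⟨e, he, h1, h2⟩
    rwa [← dart_ext h1 h2]
  · exact fun h => ⟨d, h, rfl, rfl⟩

lemma threeFacesIn_blockFrom (b : G.Dart) : M.threeFacesIn (M.blockFrom b)
    = {f | M.size f = 3 ∧ ∃ d, M.BlockDart b d ∧ M.face d = f} := by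
  ext f
  refine and_congr_right fun hf => ?_
  constructor
  · intro h
    obtain ⟨d, rfl⟩ := M.face_surjective f
    exact ⟨d, (blockFrom_adj_iff b d).1 (h d rfl), rfl⟩
  · rintro ⟨d, hd, rfl⟩ e he
    exact (blockFrom_adj_iff b e).2 (hd.of_face hf he.symm)

lemma isIcosahedralPattern_of_extremal (hG : (friendshipGraph 3).Free G) (hc : G.Connected)
    (hs : ∀ f, M.size f = 3 ∨ M.size f = 4) (hκ : M.closedBlocks = ∅)
    (hx : 4 * {d | M.Tri d}.ncard = 19 * Nat.card V) : M.IsIcosahedralPattern := by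
  obtain ⟨hM, h3, hx'⟩ := tight_of_extremal hG hκ hx
  have h9 := hM.interiorCount_eq hκ h3 hx'
  refine ⟨hc, hs, ?_, ?_, ?_⟩
  · rintro _ ⟨b, hb, rfl⟩
    exact hM.block_iso hb (h3 _ ⟨b, hb, rfl⟩) (h9 _ ⟨b, hb, rfl⟩)
  · rintro _ ⟨b, hb, rfl⟩
    have h1 := three_mul_ncard_blockFace (M := M) b
    have h2 := hM.triCount_eq (q := {d | M.BlockDart b d}) ⟨b, hb, rfl⟩
    rw [h3 _ ⟨b, hb, rfl⟩, h9 _ ⟨b, hb, rfl⟩] at h2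
    rw [show {d | M.BlockDart b d ∧ M.Tri d}.ncard = 5 * 9 + 4 * 3 from h2] at h1
    rw [threeFacesIn_blockFrom]
    omega
  · intro v
    have hpos : 0 < M.triDegree v := by
      by_cases hi : M.Interior v
      · rw [(hM v).1 hi]; omega
      · rw [((hM v).2 hi).1]; omega
    obtain ⟨d, hd, rfl⟩ := (Set.ncard_pos).1 hpos
    refine ⟨M.blockFrom d, ⟨⟨d, hd, rfl⟩, d, .base, rfl⟩, ?_⟩
    rintro _ ⟨⟨b, hb, rfl⟩, e, he, hed⟩
    rw [blockFrom_eq he]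
    refine (blockFrom_eq ?_).symm
    by_cases hi : M.Interior d.fst
    · exact blockDart_of_interior hi hed.symm
    -- A boundary vertex has only one outer dart, so `d` and `e` have the same start and lie in the
    -- same block.
    · have ho := outer_start hi (.inl hd)
      have h1 := hM.start_eq ho (by simp [hed]) (he.tri_or hb)
      have h2 := (blockDart_start_iff hi).2 (BlockDart.base (M := M) (d₀ := d))
      rw [← h1] at h2
      exact (blockDart_start_iff (hed ▸ hi)).1 h2

end RotationSystem

/-! ### Edge count of the icosahedral pattern. -/

namespace RotationSystem

variable {V : Type*} [Finite V] {G : SimpleGraph V} {M : RotationSystem G}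

attribute [local instance] finite_dart finite_face

/-- The vertices are partitioned into the 12-sets of the blocks and the 3-faces into families of 19,
so the number of 3-faces is 19n/12. As other faces have size 4, Euler's formula gives the edges. -/
lemma IsIcosahedralPattern.edge_count (h : M.IsIcosahedralPattern) (hM : M.IsPlane)
    (hn : 13 ≤ Nat.card V) : 24 * G.edgeSet.ncard + 96 = 67 * Nat.card V := by
  classical
  have hc := card_connectedComponent_of_connected h.connected
  have : Nontrivial V := Finite.one_lt_card_iff_nontrivial.1 (by omega)
  have hiso : {v : V | ∀ w, ¬ G.Adj v w} = ∅ := by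
    rw [Set.eq_empty_iff_forall_notMem]
    intro v hv
    obtain ⟨w, hw⟩ := h.connected.preconnected.exists_adj_of_nontrivial v
    exact hv w hw
  have h2 : {f | M.size f = 2} = ∅ := by
    rw [Set.eq_empty_iff_forall_notMem]
    intro f hf
    have hf : M.size f = 2 := hf
    have := h.face_size f
    omega
  have h4 := M.four_mul_card_face_le.2.2 fun f => by have := h.face_size f; omega
  rw [h2, Set.ncard_empty] at h4
  have hV : Nat.card V = 12 * {B | M.IsTriangularBlock B}.ncard := by
    choose f hf hf' using h.vertex_block
    rw [← ncard_preimage_eq_mul f, ← Set.ncard_univ]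
    · congr 1
      exact (Set.eq_univ_of_forall fun v => (hf v).1).symm
    · intro B hB
      obtain ⟨e⟩ := h.block_iso B hB
      have h12 : Nat.card (Bool × Option (ZMod 5)) = 12 := by
        rw [Nat.card_eq_fintype_card]; rfl
      rw [← h12, ← Nat.card_congr e.toEquiv, Nat.card_coe_set_eq]
      congr 1
      ext v
      constructor
      · rintro rfl
        exact (hf v).2
      · exact fun hv => (hf' v B ⟨hB, hv⟩).symm
  have hF : {f | M.size f = 3}.ncard = 19 * {B | M.IsTriangularBlock B}.ncard := by
    choose g hg using M.face_surjective
    rw [← ncard_preimage_eq_mul (fun f : {f // M.size f = 3} => M.blockFrom (g f.1)),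
      ← Set.ncard_image_of_injective _ Subtype.val_injective]
    · congr 1
      ext f
      constructor
      · intro hf
        exact ⟨⟨f, hf⟩, ⟨g f, by rw [hg]; exact hf, rfl⟩, rfl⟩
      · rintro ⟨f, -, rfl⟩
        exact f.2
    · intro B hB
      rw [← h.block_faces B hB, ← Set.ncard_image_of_injective _ Subtype.val_injective]
      congr 1
      ext f
      constructor
      · rintro ⟨f, rfl, rfl⟩
        rw [threeFacesIn_blockFrom]
        exact ⟨f.2, g f.1, .base, hg f.1⟩
      · rintro ⟨hf, hB'⟩
        refine ⟨⟨f, hf⟩, ?_, rfl⟩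
        refine (h.vertex_block (g f).fst).unique ⟨⟨g f, by rw [hg]; exact hf, rfl⟩, g f, .base, rfl⟩
          ⟨hB, B.edge_vert (hB' (g f) (hg f))⟩
  unfold IsPlane at hM
  rw [hc, hiso, Set.ncard_empty] at hM
  omega

theorem edge_count_iff (hM : M.IsPlane) (hG : (friendshipGraph 3).Free G) (hn : 13 ≤ Nat.card V) :
    24 * G.edgeSet.ncard + 96 = 67 * Nat.card V ↔ M.IsIcosahedralPattern := by
  constructor
  · intro h
    obtain ⟨h1, h2, h3, h4⟩ := (edge_bound hM hG hn).2 h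
    exact isIcosahedralPattern_of_extremal hG h1 h2 h3 h4
  · exact fun h => h.edge_count hM hn

end RotationSystem

/-! ### Rotation systems from cyclic lists of neighbours. -/

/-- `nb` lists the neighbours of every vertex in cyclic order; vertices are given by their codes
under `ι`. -/
structure IsNeighborList {U V : Type*} (ι : V → U) (nb : U → List U) : Prop where
  injective : Function.Injective ι
  nodup : ∀ v, (nb (ι v)).Nodup
  mem_range : ∀ v, ∀ u ∈ nb (ι v), ∃ w, ι w = u
  symm : ∀ v w, ι w ∈ nb (ι v) → ι v ∈ nb (ι w)
  irrefl : ∀ v, ι v ∉ nb (ι v)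

namespace IsNeighborList

variable {U V : Type*} {ι : V → U} {nb : U → List U} (h : IsNeighborList ι nb)

/-- The graph given by lists of neighbours. -/
def graph (h : IsNeighborList ι nb) : SimpleGraph V where
  Adj v w := ι w ∈ nb (ι v)
  symm := ⟨h.symm⟩
  loopless := ⟨h.irrefl⟩

lemma dart_mem (d : h.graph.Dart) : ι d.snd ∈ nb (ι d.fst) := d.adj

variable [DecidableEq U]

lemma exists_next (d : h.graph.Dart) : ∃ e : h.graph.Dart, e.fst = d.fst ∧
    ι e.snd = (nb (ι d.fst)).formPerm (ι d.snd) := by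
  have h1 := List.formPerm_apply_mem_of_mem (h.dart_mem d)
  obtain ⟨w, hw⟩ := h.mem_range _ _ h1
  exact ⟨⟨(d.fst, w), by rw [← hw] at h1; exact h1⟩, rfl, hw⟩

/-- The dart following a dart in the cyclic order of the neighbours. -/
noncomputable def nextDart (d : h.graph.Dart) : h.graph.Dart := (h.exists_next d).choose

@[simp] lemma nextDart_fst (d : h.graph.Dart) : (h.nextDart d).fst = d.fst :=
  (h.exists_next d).choose_spec.1

lemma nextDart_snd (d : h.graph.Dart) :
    ι (h.nextDart d).snd = (nb (ι d.fst)).formPerm (ι d.snd) :=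
  (h.exists_next d).choose_spec.2

lemma nextDart_injective : Function.Injective h.nextDart := by
  intro d e hde
  have h1 : d.fst = e.fst := by rw [← h.nextDart_fst d, hde, nextDart_fst]
  refine dart_ext h1 (h.injective ?_)
  apply ((nb (ι d.fst)).formPerm).injective
  rw [← h.nextDart_snd, hde, h.nextDart_snd, h1]

lemma iterate_nextDart (d : h.graph.Dart) (k : ℕ) : (h.nextDart^[k] d).fst = d.fst ∧
    ι (h.nextDart^[k] d).snd = ((nb (ι d.fst)).formPerm ^ k) (ι d.snd) := by
  induction k with
  | zero => exact ⟨rfl, rfl⟩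
  | succ k ih =>
    rw [Function.iterate_succ_apply', nextDart_fst, h.nextDart_snd, ih.1, ih.2, pow_succ',
      Equiv.Perm.mul_apply]
    exact ⟨rfl, rfl⟩

lemma exists_formPerm_pow {l : List U} (hl : l.Nodup) {x y : U} (hx : x ∈ l) (hy : y ∈ l) :
    ∃ k : ℕ, (l.formPerm ^ k) x = y := by
  obtain ⟨i, hi, rfl⟩ := List.getElem_of_mem hx
  obtain ⟨j, hj, rfl⟩ := List.getElem_of_mem hy
  -- The exponent is j - i modulo the length, shifted by one length to stay within the naturals.
  refine ⟨l.length - i + j, ?_⟩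
  rw [List.formPerm_pow_apply_getElem l hl]
  congr 1
  rw [show i + (l.length - i + j) = j + l.length by omega, Nat.add_mod_right, Nat.mod_eq_of_lt hj]

variable [Finite V]

attribute [local instance] RotationSystem.finite_dart

/-- The rotation system given by lists of neighbours. -/
noncomputable def rotation : RotationSystem h.graph where
  next := Equiv.ofBijective h.nextDart (Finite.injective_iff_bijective.1 h.nextDart_injective)
  sameCycle_iff d e := by
    set p := Equiv.ofBijective h.nextDart (Finite.injective_iff_bijective.1 h.nextDart_injective)
    have hp : ∀ k : ℕ, (p ^ k) d = h.nextDart^[k] d := fun k => by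
      rw [← Equiv.Perm.iterate_eq_pow]; rfl
    constructor
    · intro hde
      obtain ⟨k, rfl⟩ := hde.exists_nat_pow_eq
      rw [hp, (h.iterate_nextDart d k).1]
    · intro hde
      have h1 := h.dart_mem e
      rw [← hde] at h1
      obtain ⟨k, hk⟩ := exists_formPerm_pow (h.nodup d.fst) (h.dart_mem d) h1
      refine ⟨k, ?_⟩
      rw [zpow_natCast, hp]
      refine dart_ext ((h.iterate_nextDart d k).1.trans hde) (h.injective ?_)
      rw [(h.iterate_nextDart d k).2, hk]

/-- The next dart of a face boundary, in terms of the codes of the ends. -/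
def codeStep (nb : U → List U) (p : U × U) : U × U := (p.2, (nb p.2).formPerm p.1)

/-- The codes of the ends of a dart. -/
def code (d : h.graph.Dart) : U × U := (ι d.fst, ι d.snd)

omit [DecidableEq U] [Finite V] in
lemma code_injective : Function.Injective h.code := fun _ _ hde =>
  dart_ext (h.injective (congrArg Prod.fst hde)) (h.injective (congrArg Prod.snd hde))

lemma code_facePerm (d : h.graph.Dart) :
    h.code (h.rotation.facePerm d) = codeStep nb (h.code d) :=
  Prod.ext (congrArg ι (h.nextDart_fst d.symm)) (h.nextDart_snd d.symm)

lemma code_facePerm_iterate (d : h.graph.Dart) (k : ℕ) :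
    h.code (h.rotation.facePerm^[k] d) = (codeStep nb)^[k] (h.code d) := by
  induction k with
  | zero => rfl
  | succ k ih => rw [Function.iterate_succ_apply', Function.iterate_succ_apply', code_facePerm, ih]

lemma facePerm_iterate_eq_iff (d : h.graph.Dart) (k : ℕ) :
    h.rotation.facePerm^[k] d = d ↔ (codeStep nb)^[k] (h.code d) = h.code d := by
  rw [← code_facePerm_iterate, h.code_injective.eq_iff]

end IsNeighborList

/-! ### One link of the chain: finite verifications. -/

section Link

set_option synthInstance.maxHeartbeats 400000
set_option synthInstance.maxSize 4000

/-- Vertices of a link of the extremal chain: two icosahedra. -/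
abbrev LinkVertex := Bool × Bool × Option (ZMod 5)

/-- The neighbours of a vertex of the icosahedron in cyclic order, the list being cut at the outer
face, which is bounded by the pole `(true, none)` and the vertices `(true, some 0)` and
`(true, some 4)`. -/
def icoList (w : Bool × Option (ZMod 5)) : List (Bool × Option (ZMod 5)) :=
  (if w = (true, some 0) then [1, 2, 3, 4, 0] else [0, 1, 2, 3, 4]).map (icoNeighbor w)

/-- The neighbours of a vertex of a link outside its icosahedron, in cyclic order and together with
the relative position of their link in the chain. The flags tell whether the link is the first or
the last one. The outer triangles of both icosahedra of a link form a prism, and successive prisms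
are joined through two of their quadrilaterals. -/
def outerList (first last : Bool) (a : LinkVertex) : List (ℤ × LinkVertex) :=
  if a = (false, true, none) then
    (0, true, true, none) :: if first then [] else [(-1, false, true, some 4)]
  else if a = (false, true, some 0) then
    (if first then [] else [(-1, false, true, some 0)]) ++ (0, true, true, some 4) ::
      if last then [] else [(1, false, true, some 0)]
  else if a = (false, true, some 4) then
    (if last then [] else [(1, false, true, none)]) ++ [(0, true, true, some 0)]
  else if a = (true, true, none) then
    (if first then [] else [(-1, true, true, some 0)]) ++ [(0, false, true, none)]
  else if a = (true, true, some 4) then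
    (if last then [] else [(1, true, true, some 4)]) ++ (0, false, true, some 0) ::
      if first then [] else [(-1, true, true, some 4)]
  else if a = (true, true, some 0) then
    (0, false, true, some 4) :: if last then [] else [(1, true, true, none)]
  else []

/-- The neighbours of a vertex of a link in cyclic order, with the relative positions of their
links. -/
def linkList (first last : Bool) (a : LinkVertex) : List (ℤ × LinkVertex) :=
  (icoList a.2).map (fun w => (0, a.1, w)) ++ outerList first last a

/-- The flags of the link at a position relative to a given one. -/
def flagAt (e : Bool × Bool × Bool × Bool) (o : ℤ) : Bool × Bool :=
  if o = 0 then (e.2.1, e.2.2.1) else if o = 1 then (false, e.2.2.2) else (e.1, false)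

/-- The step along the boundary of a face from a dart given by the relative position of its link,
its initial vertex and the relative position of its terminal vertex. -/
def faceStep (e : Bool × Bool × Bool × Bool) (d : ℤ × LinkVertex × ℤ × LinkVertex) :
    ℤ × LinkVertex × ℤ × LinkVertex :=
  (d.1 + d.2.2.1, d.2.2.2, (linkList (flagAt e (d.1 + d.2.2.1)).1 (flagAt e (d.1 + d.2.2.1)).2
    d.2.2.2).formPerm (-d.2.2.1, d.2.1))

lemma linkList_nodup : ∀ (f l : Bool) (a : LinkVertex), (linkList f l a).Nodup := by
  decide +kernel

lemma linkList_shift : ∀ (f l : Bool) (a : LinkVertex), ∀ x ∈ linkList f l a,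
    (x.1 = 0 ∧ x.2 ≠ a) ∨ (x.1 = 1 ∧ l = false) ∨ (x.1 = -1 ∧ f = false) := by
  decide +kernel

lemma linkList_symm : ∀ (e : Bool × Bool × Bool × Bool) (a : LinkVertex),
    ∀ x ∈ linkList e.2.1 e.2.2.1 a,
      (-x.1, a) ∈ linkList (flagAt e x.1).1 (flagAt e x.1).2 x.2 := by
  decide +kernel

/-- Whether the face of a dart is a triangle. -/
def IsTriStep (a : LinkVertex) (x : ℤ × LinkVertex) : Bool :=
  (faceStep (false, false, false, false))^[3] (0, a, x) = (0, a, x)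

lemma faceStep_three : ∀ (e : Bool × Bool × Bool × Bool) (a : LinkVertex),
    ∀ x ∈ linkList e.2.1 e.2.2.1 a, IsTriStep a x →
    (faceStep e (0, a, x)).1 ∈ [-1, 0, 1] ∧ ((faceStep e)^[2] (0, a, x)).1 ∈ [-1, 0, 1] ∧
      (faceStep e)^[3] (0, a, x) = (0, a, x) := by
  decide +kernel

lemma faceStep_four : ∀ (e : Bool × Bool × Bool × Bool) (a : LinkVertex),
    ∀ x ∈ linkList e.2.1 e.2.2.1 a, ¬ IsTriStep a x →
    (faceStep e (0, a, x)).1 ∈ [-1, 0, 1] ∧ ((faceStep e)^[2] (0, a, x)).1 ∈ [-1, 0, 1] ∧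
      ((faceStep e)^[3] (0, a, x)).1 ∈ [-1, 0, 1] ∧ (faceStep e)^[4] (0, a, x) = (0, a, x) := by
  decide +kernel

/-- Of the 126 darts, 120 belong to the two icosahedra and 6 to the three edges between them; four
more lead to each adjacent link. -/
lemma sum_length_linkList : ∀ f l : Bool, ∑ a, (linkList f l a).length
    = 126 + (if f then 0 else 4) + (if l then 0 else 4) := by
  decide +kernel

/-- Two icosahedra with 19 triangular faces each: 2 · 19 · 3 darts. -/
lemma sum_isTriStep : ∀ f l : Bool,
    ∑ a, ((linkList f l a).filter fun x => IsTriStep a x).length = 114 := by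
  decide +kernel

/-- Edges outside the icosahedra lie in no triangle. Inner links suffice, as the end links only have
fewer edges (`linkList_subset`). -/
lemma linkList_triangle : ∀ (a : LinkVertex), ∀ x ∈ linkList false false a,
    ∀ y ∈ linkList false false a, (y.1 - x.1, y.2) ∈ linkList false false x.2 →
      x ∈ (icoList a.2).map (fun w => ((0 : ℤ), a.1, w)) := by
  decide +kernel

/-- The distance of a vertex of a link from the first pole, roughly. -/
def linkRank (a : LinkVertex) : ℕ :=
  (if a.1 then 10 else 0) + match a.2 with
    | (true, none) => 0
    | (true, some _) => 1
    | (false, some _) => 2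
    | (false, none) => 3

lemma linkList_rank : ∀ (f l : Bool) (a : LinkVertex), a = (false, true, none) ∧ f ∨
    ∃ x ∈ linkList f l a, x.1 = -1 ∨ x.1 = 0 ∧ linkRank x.2 < linkRank a := by
  decide +kernel

lemma linkList_subset : ∀ (f l : Bool) (a : LinkVertex),
    ∀ x ∈ linkList f l a, x ∈ linkList false false a := by
  decide +kernel

end Link

/-! ### The chain of `k` links. -/

/-- Whether a link of the chain of length `k` is the first and the last one. -/
def chainFlag (k : ℕ) (z : ℤ) : Bool × Bool := (decide (z = 0), decide (z = k - 1))

/-- The lists of neighbours in the chain of `k` links. -/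
def chainList (k : ℕ) (u : ℤ × LinkVertex) : List (ℤ × LinkVertex) :=
  (linkList (chainFlag k u.1).1 (chainFlag k u.1).2 u.2).map fun x => (u.1 + x.1, x.2)

/-- The flags of a link and of its neighbours. -/
def chainEnv (k : ℕ) (z : ℤ) : Bool × Bool × Bool × Bool :=
  (decide (z - 1 = 0), decide (z = 0), decide (z = k - 1), decide (z + 1 = k - 1))

/-- The link after `z` is never the first and the one before is never the last, so four flags
describe three consecutive links. The default branch of `flagAt` is right only at -1, hence `ho`. -/
lemma chainFlag_add {k : ℕ} {z : ℤ} (h₀ : 0 ≤ z) (h₁ : z < k) {o : ℤ} (ho : o ∈ [-1, 0, 1]) :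
    chainFlag k (z + o) = flagAt (chainEnv k z) o := by
  simp only [List.mem_cons, List.not_mem_nil, or_false] at ho
  rcases ho with rfl | rfl | rfl
  · simp [chainFlag, flagAt, chainEnv]
    omega
  · simp [chainFlag, flagAt, chainEnv]
  · simp [chainFlag, flagAt, chainEnv]
    omega

lemma mem_linkList_bounds {k : ℕ} {z : ℤ} (h₀ : 0 ≤ z) (h₁ : z < k) {a : LinkVertex}
    {x : ℤ × LinkVertex} (hx : x ∈ linkList (chainFlag k z).1 (chainFlag k z).2 a) :
    x.1 ∈ [-1, 0, 1] ∧ 0 ≤ z + x.1 ∧ z + x.1 < k := by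
  have h := linkList_shift _ _ _ x hx
  simp only [chainFlag, decide_eq_false_iff_not] at h
  simp only [List.mem_cons, List.not_mem_nil, or_false]
  omega

lemma mem_linkList_symm {k : ℕ} {z : ℤ} (h₀ : 0 ≤ z) (h₁ : z < k) {a : LinkVertex}
    {x : ℤ × LinkVertex} (hx : x ∈ linkList (chainFlag k z).1 (chainFlag k z).2 a) :
    (-x.1, a) ∈ linkList (chainFlag k (z + x.1)).1 (chainFlag k (z + x.1)).2 x.2 := by
  rw [chainFlag_add h₀ h₁ (mem_linkList_bounds h₀ h₁ hx).1]
  exact linkList_symm (chainEnv k z) a x hx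

lemma formPerm_map {α β : Type*} [DecidableEq α] [DecidableEq β] {g : α → β}
    (hg : Function.Injective g) {l : List α} (hl : l.Nodup) {x : α} (hx : x ∈ l) :
    (l.map g).formPerm (g x) = g (l.formPerm x) := by
  obtain ⟨i, hi, rfl⟩ := List.getElem_of_mem hx
  have hi' : i < (l.map g).length := by rwa [List.length_map]
  rw [List.formPerm_apply_getElem l hl i hi, ← List.getElem_map g (h := hi'),
    List.formPerm_apply_getElem _ (hl.map hg) i hi', List.getElem_map]
  congr 2
  rw [List.length_map]

/-- The codes of the ends of a dart given by positions relative to a link. -/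
def place (z : ℤ) (d : ℤ × LinkVertex × ℤ × LinkVertex) : (ℤ × LinkVertex) × (ℤ × LinkVertex) :=
  ((z + d.1, d.2.1), (z + d.1 + d.2.2.1, d.2.2.2))

/-- The relative positions describe a dart of the chain. -/
def IsPlaced (k : ℕ) (z : ℤ) (d : ℤ × LinkVertex × ℤ × LinkVertex) : Prop :=
  0 ≤ z + d.1 ∧ z + d.1 < k ∧
    d.2.2 ∈ linkList (chainFlag k (z + d.1)).1 (chainFlag k (z + d.1)).2 d.2.1

/-- The relative walk agrees with the walk in the chain as long as it stays within one link of `z`,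
where the flags are known; this transfers the finite verifications to every `k`. -/
lemma codeStep_place {k : ℕ} {z : ℤ} (h₀ : 0 ≤ z) (h₁ : z < k)
    {d : ℤ × LinkVertex × ℤ × LinkVertex} (hd : IsPlaced k z d)
    (ho : (faceStep (chainEnv k z) d).1 ∈ [-1, 0, 1]) :
    IsNeighborList.codeStep (chainList k) (place z d) = place z (faceStep (chainEnv k z) d) ∧
      IsPlaced k z (faceStep (chainEnv k z) d) := by
  obtain ⟨o, a, δ, b⟩ := d
  obtain ⟨h2, h3, hx⟩ := hd
  simp only at h2 h3 hx
  have hs := mem_linkList_symm h2 h3 hx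
  have hb := mem_linkList_bounds h2 h3 hx
  have hf := chainFlag_add h₀ h₁ ho
  simp only [faceStep] at hf
  simp only [← add_assoc] at hf
  simp only at hs hb
  have hinj : Function.Injective fun x : ℤ × LinkVertex => (z + o + δ + x.1, x.2) := by
    intro x y hxy
    simp only [Prod.mk.injEq, add_right_inj] at hxy
    exact Prod.ext hxy.1 hxy.2
  have key := formPerm_map hinj (linkList_nodup _ _ b) hs
  simp only [add_neg_cancel_right] at key
  simp only [faceStep, place, IsNeighborList.codeStep, chainList, IsPlaced, ← add_assoc, key, ← hf]
  exact ⟨trivial, hb.2.1, hb.2.2, List.formPerm_apply_mem_of_mem hs⟩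

section Chain

variable {V : Type*} {k : ℕ} (e : V ≃ Fin k × LinkVertex)

/-- The code of a vertex of the chain. -/
def chainCode (v : V) : ℤ × LinkVertex := (((e v).1.val : ℤ), (e v).2)

lemma chainCode_nonneg (v : V) : 0 ≤ (chainCode e v).1 := Int.natCast_nonneg _

lemma chainCode_lt (v : V) : (chainCode e v).1 < k := Int.ofNat_lt.2 (e v).1.2

lemma isNeighborList_chain : IsNeighborList (chainCode e) (chainList k) where
  injective v w h := by
    simp only [chainCode, Prod.mk.injEq, Nat.cast_inj] at h
    exact e.injective (Prod.ext (Fin.ext h.1) h.2)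
  nodup v := by
    refine (linkList_nodup _ _ _).map fun x y hxy => ?_
    simp only [Prod.mk.injEq, add_right_inj] at hxy
    exact Prod.ext hxy.1 hxy.2
  mem_range v u hu := by
    obtain ⟨x, hx, rfl⟩ := List.mem_map.1 hu
    obtain ⟨-, h1, h2⟩ := mem_linkList_bounds (chainCode_nonneg e v) (chainCode_lt e v) hx
    obtain ⟨m, hm⟩ := Int.eq_ofNat_of_zero_le h1
    refine ⟨e.symm (⟨m, by omega⟩, x.2), ?_⟩
    simp [chainCode] at hm ⊢
    omega
  symm v w h := by
    obtain ⟨x, hx, hw⟩ := List.mem_map.1 h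
    have := mem_linkList_symm (chainCode_nonneg e v) (chainCode_lt e v) hx
    rw [← hw]
    exact List.mem_map.2 ⟨_, this, Prod.ext (by simp) rfl⟩
  irrefl v h := by
    obtain ⟨x, hx, hw⟩ := List.mem_map.1 h
    have h1 := congrArg Prod.fst hw
    have h2 := congrArg Prod.snd hw
    simp only [add_eq_left] at h1 h2
    rcases linkList_shift _ _ _ x hx with h3 | h3 | h3
    · exact h3.2 h2
    · omega
    · omega

/-- The extremal graph: a chain of links. -/
abbrev chainGraph : SimpleGraph V := (isNeighborList_chain e).graph

/-- The position of the terminal vertex of a dart relative to its initial vertex. -/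
def relPos (d : (chainGraph e).Dart) : ℤ × LinkVertex :=
  ((chainCode e d.snd).1 - (chainCode e d.fst).1, (chainCode e d.snd).2)

lemma relPos_mem (d : (chainGraph e).Dart) : relPos e d ∈
    linkList (chainFlag k (chainCode e d.fst).1).1 (chainFlag k (chainCode e d.fst).1).2
      (chainCode e d.fst).2 := by
  obtain ⟨x, hx, h⟩ := List.mem_map.1 d.adj
  rw [relPos, ← h]
  simpa using hx

lemma code_eq_place (d : (chainGraph e).Dart) : (isNeighborList_chain e).code d
    = place (chainCode e d.fst).1 (0, (chainCode e d.fst).2, relPos e d) := by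
  simp [IsNeighborList.code, place, relPos]

lemma isPlaced_dart (d : (chainGraph e).Dart) :
    IsPlaced k (chainCode e d.fst).1 (0, (chainCode e d.fst).2, relPos e d) := by
  have := relPos_mem e d
  simp only [IsPlaced, add_zero]
  exact ⟨chainCode_nonneg e _, chainCode_lt e _, this⟩

variable [Finite V]

/-- The rotation system of the chain. -/
noncomputable abbrev chainRotation : RotationSystem (chainGraph e) :=
  (isNeighborList_chain e).rotation

lemma chain_iterate_three (d : (chainGraph e).Dart)
    (h : IsTriStep (chainCode e d.fst).2 (relPos e d)) :
    (chainRotation e).facePerm^[3] d = d := by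
  rw [IsNeighborList.facePerm_iterate_eq_iff, code_eq_place]
  obtain ⟨h1, h2, h3⟩ := faceStep_three (chainEnv k (chainCode e d.fst).1) _ _ (relPos_mem e d) h
  have h0 := chainCode_nonneg e d.fst
  have h0' := chainCode_lt e d.fst
  have s1 := codeStep_place h0 h0' (isPlaced_dart e d) h1
  have s2 := codeStep_place h0 h0' s1.2 h2
  have s3 := codeStep_place h0 h0' s2.2
    (by change ((faceStep (chainEnv k (chainCode e d.fst).1))^[3] _).1 ∈ _; rw [h3]; simp)
  change IsNeighborList.codeStep _ (IsNeighborList.codeStep _ (IsNeighborList.codeStep _ _)) = _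
  rw [s1.1, s2.1, s3.1]
  exact congrArg _ h3

lemma chain_iterate_four (d : (chainGraph e).Dart)
    (h : ¬ IsTriStep (chainCode e d.fst).2 (relPos e d)) :
    (chainRotation e).facePerm^[4] d = d := by
  rw [IsNeighborList.facePerm_iterate_eq_iff, code_eq_place]
  obtain ⟨h1, h2, h3, h4⟩ :=
    faceStep_four (chainEnv k (chainCode e d.fst).1) _ _ (relPos_mem e d) h
  have h0 := chainCode_nonneg e d.fst
  have h0' := chainCode_lt e d.fst
  have s1 := codeStep_place h0 h0' (isPlaced_dart e d) h1
  have s2 := codeStep_place h0 h0' s1.2 h2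
  have s3 := codeStep_place h0 h0' s2.2 h3
  have s4 := codeStep_place h0 h0' s3.2
    (by change ((faceStep (chainEnv k (chainCode e d.fst).1))^[4] _).1 ∈ _; rw [h4]; simp)
  change IsNeighborList.codeStep _ (IsNeighborList.codeStep _ (IsNeighborList.codeStep _
    (IsNeighborList.codeStep _ _))) = _
  rw [s1.1, s2.1, s3.1, s4.1]
  exact congrArg _ h4

/-- A walk closing after four steps cannot have period 3, and one closing after three has period 3
since there are no faces of size 1. -/
lemma chain_tri_iff (d : (chainGraph e).Dart) : (chainRotation e).Tri d ↔
    IsTriStep (chainCode e d.fst).2 (relPos e d) := by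
  have h1 := (chainRotation e).size_face_ne_one d
  rw [RotationSystem.Tri]
  rw [RotationSystem.size_face] at h1 ⊢
  constructor
  · intro h
    by_contra hd
    have := Function.IsPeriodicPt.minimalPeriod_dvd (chain_iterate_four e d hd)
    rw [h] at this
    omega
  · intro h
    have := Function.IsPeriodicPt.minimalPeriod_dvd (chain_iterate_three e d h)
    exact ((Nat.dvd_prime Nat.prime_three).1 this).resolve_left h1

lemma chain_size_le (f : (chainRotation e).Face) : (chainRotation e).size f ≤ 4 := by
  obtain ⟨d, rfl⟩ := (chainRotation e).face_surjective f
  rw [RotationSystem.size_face]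
  by_cases h : IsTriStep (chainCode e d.fst).2 (relPos e d)
  · have := Function.IsPeriodicPt.minimalPeriod_le (by omega) (chain_iterate_three e d h)
    omega
  · exact Function.IsPeriodicPt.minimalPeriod_le (by omega) (chain_iterate_four e d h)

attribute [local instance] RotationSystem.finite_dart RotationSystem.finite_face

lemma ncard_chain_dart (p : LinkVertex → ℤ × LinkVertex → Bool) :
    {d : (chainGraph e).Dart | p (chainCode e d.fst).2 (relPos e d)}.ncard
      = ∑ z : Fin k, ∑ a, ((linkList (chainFlag k z.val).1 (chainFlag k z.val).2 a).filter
          (p a)).length := by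
  classical
  have := Fintype.ofFinite V
  rw [ncard_eq_sum_fiber _ (fun d => d.fst) Finset.univ (by simp), ← Fintype.sum_prod_type',
    ← Equiv.sum_comp e]
  refine Finset.sum_congr rfl fun v _ => ?_
  have hinj : Set.InjOn (relPos e) {d | d ∈ {d : (chainGraph e).Dart |
      p (chainCode e d.fst).2 (relPos e d)} ∧ d.fst = v} := by
    rintro d ⟨-, rfl⟩ d' ⟨-, hd'⟩ h
    refine dart_ext hd'.symm ((isNeighborList_chain e).injective ?_)
    simp only [relPos, hd', Prod.mk.injEq, sub_left_inj] at h
    exact Prod.ext h.1 h.2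
  rw [← hinj.ncard_image, ← List.toFinset_card_of_nodup ((linkList_nodup _ _ _).filter _),
    ← Set.ncard_coe_finset]
  congr 1
  ext x
  rw [List.coe_toFinset, Set.mem_ofPred_eq, List.mem_filter]
  constructor
  · rintro ⟨d, ⟨hp, rfl⟩, rfl⟩
    exact ⟨relPos_mem e d, hp⟩
  · rintro ⟨hx, hp⟩
    have hmem : ((chainCode e v).1 + x.1, x.2) ∈ chainList k (chainCode e v) :=
      List.mem_map.2 ⟨x, hx, rfl⟩
    obtain ⟨w, hw⟩ := (isNeighborList_chain e).mem_range v _ hmem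
    have hrel : relPos e ⟨(v, w), show chainCode e w ∈ _ by rw [hw]; exact hmem⟩ = x := by
      simp [relPos, hw]
    refine ⟨⟨(v, w), show chainCode e w ∈ _ by rw [hw]; exact hmem⟩, ⟨?_, rfl⟩, hrel⟩
    rw [Set.mem_ofPred_eq, hrel]
    exact hp

lemma ncard_chain_tri : {d | (chainRotation e).Tri d}.ncard = 114 * k := by
  simp only [chain_tri_iff]
  rw [ncard_chain_dart e IsTriStep]
  simp only [sum_isTriStep]
  simp [mul_comm]

/-- The missing 8 darts are the four absent at each end; for k = 1 both losses fall on the same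
link. -/
lemma card_chain_dart (hk : 0 < k) : Nat.card (chainGraph e).Dart + 8 = 134 * k := by
  have h := ncard_chain_dart e fun _ _ => true
  have h1 : {d : (chainGraph e).Dart | (fun _ _ => true : LinkVertex → ℤ × LinkVertex → Bool)
      (chainCode e d.fst).2 (relPos e d) = true} = Set.univ := by
    ext; simp
  rw [h1, Set.ncard_univ] at h
  simp only [List.filter_true, sum_length_linkList] at h
  have h2 : ∀ z₀ : Fin k, ∑ z : Fin k, (if z = z₀ then 0 else 4) + 4 = 4 * k := by
    intro z₀
    have : ∑ z : Fin k, ((if z = z₀ then 0 else 4) + if z = z₀ then 4 else 0) = 4 * k := by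
      rw [Finset.sum_congr rfl (g := fun _ => 4)]
      · simp [mul_comm]
      · intro z _; split_ifs <;> rfl
    rwa [Finset.sum_add_distrib, Finset.sum_ite_eq' Finset.univ z₀ fun _ => 4,
      if_pos (Finset.mem_univ _)] at this
  have h3 : ∀ z : Fin k, ((chainFlag k z.val).1 = true ↔ z = ⟨0, hk⟩) := by
    intro z
    simp [chainFlag, Fin.ext_iff]
  have h4 : ∀ z : Fin k, ((chainFlag k z.val).2 = true ↔ z = ⟨k - 1, by omega⟩) := by
    intro z
    simp [chainFlag, Fin.ext_iff]
    omega
  simp only [h3, h4, Finset.sum_add_distrib] at h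
  have h5 := h2 ⟨0, hk⟩
  have h6 := h2 ⟨k - 1, by omega⟩
  rw [h]
  simp only [Finset.sum_const, Finset.card_univ, Fintype.card_fin, smul_eq_mul] at *
  omega

omit [Finite V] in
lemma chain_connected (hk : 0 < k) : (chainGraph e).Connected := by
  -- With weight 20 on the link, moving to the previous link outweighs any change of rank, so the
  -- neighbour from `linkList_rank` always lowers the measure.
  have hlt : ∀ a, linkRank a < 20 := by decide
  have key : ∀ m v, (20 * (chainCode e v).1 + linkRank (chainCode e v).2).toNat = m →
      (chainGraph e).Reachable v (e.symm (⟨0, hk⟩, false, true, none)) := by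
    intro m
    induction m using Nat.strong_induction_on with
    | _ m ih =>
      intro v hv
      have h0 := chainCode_nonneg e v
      rcases linkList_rank (chainFlag k (chainCode e v).1).1 (chainFlag k (chainCode e v).1).2
        (chainCode e v).2 with ⟨h1, h2⟩ | ⟨x, hx, hlt'⟩
      · have : v = e.symm (⟨0, hk⟩, false, true, none) := by
          rw [Equiv.eq_symm_apply]
          refine Prod.ext (Fin.ext ?_) h1
          simpa [chainFlag, chainCode] using h2
        rw [this]
      · have hmem : ((chainCode e v).1 + x.1, x.2) ∈ chainList k (chainCode e v) :=
          List.mem_map.2 ⟨x, hx, rfl⟩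
        obtain ⟨w, hw⟩ := (isNeighborList_chain e).mem_range v _ hmem
        have hadj : (chainGraph e).Adj v w := show chainCode e w ∈ _ by rw [hw]; exact hmem
        refine hadj.reachable.trans (ih _ ?_ w rfl)
        have h1 := chainCode_nonneg e w
        rw [hw] at h1 ⊢
        have h2 := hlt x.2
        simp only at h1 ⊢
        omega
  have : Nonempty V := ⟨e.symm (⟨0, hk⟩, false, true, none)⟩
  exact ⟨fun v w => (key _ v rfl).trans (key _ w rfl).symm⟩

lemma length_icoList (w : Bool × Option (ZMod 5)) : (icoList w).length = 5 := by
  rw [icoList, List.length_map]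
  split_ifs <;> rfl

omit [Finite V] in
-- Every triangle at the centre uses neighbours within the icosahedron of the centre. There are only
-- five of these, and H_3 needs six.
lemma chain_free : (friendshipGraph 3).Free (chainGraph e) := by
  classical
  rintro ⟨⟨f, hf⟩⟩
  have hc : ∀ p : Fin 3 × Bool, (chainGraph e).Adj (f none) (f (some p)) := fun p =>
    f.map_adj ⟨by simp, by simp⟩
  let x : Fin 3 × Bool → ℤ × LinkVertex := fun p => relPos e ⟨(f none, f (some p)), hc p⟩
  have hx : ∀ p, x p ∈ linkList false false (chainCode e (f none)).2 := fun p =>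
    linkList_subset _ _ _ _ (relPos_mem e _)
  have hxi : Function.Injective x := by
    intro p q hpq
    simp only [x, relPos, Prod.mk.injEq, sub_left_inj] at hpq
    have := hf ((isNeighborList_chain e).injective (Prod.ext hpq.1 hpq.2))
    exact Option.some_injective _ this
  have hmem : ∀ p, x p ∈ (icoList (chainCode e (f none)).2.2).map
      (fun w => ((0 : ℤ), (chainCode e (f none)).2.1, w)) := by
    intro p
    have hadj : (chainGraph e).Adj (f (some p)) (f (some (p.1, !p.2))) :=
      f.map_adj ⟨by simp [Prod.ext_iff], by simp⟩
    refine linkList_triangle _ _ (hx p) _ (hx (p.1, !p.2)) ?_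
    have := linkList_subset _ _ _ _ (relPos_mem e ⟨(f (some p), f (some (p.1, !p.2))), hadj⟩)
    simpa [x, relPos] using this
  have h1 : (Finset.univ.image x).card = 6 := by
    rw [Finset.card_image_of_injective _ hxi]; rfl
  have h2 := Finset.card_le_card (show Finset.univ.image x ⊆ List.toFinset _ from fun y hy => by
    obtain ⟨p, -, rfl⟩ := Finset.mem_image.1 hy
    exact List.mem_toFinset.2 (hmem p))
  have h3 := List.toFinset_card_le ((icoList (chainCode e (f none)).2.2).map
      (fun w => ((0 : ℤ), (chainCode e (f none)).2.1, w)))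
  rw [List.length_map, length_icoList] at h3
  omega

omit [Finite V] in
lemma card_chain (e : V ≃ Fin k × LinkVertex) : Nat.card V = 24 * k := by
  rw [Nat.card_congr e, Nat.card_prod, Nat.card_fin, Nat.card_eq_fintype_card (α := LinkVertex)]
  rw [show Fintype.card LinkVertex = 24 from rfl, mul_comm]

lemma chain_edges (hk : 0 < k) : (chainGraph e).edgeSet.ncard + 4 = 67 * k := by
  have h1 := card_chain_dart e hk
  rw [← RotationSystem.two_mul_ncard_edgeSet] at h1
  omega

/-- Genus zero is an identity between counts: 24k vertices, 67k - 4 edges and 38k 3-faces, the other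
faces having size 4, make 43k - 2 faces and Euler characteristic 2. -/
lemma chain_isPlane (hk : 0 < k) : (chainRotation e).IsPlane := by
  have hc := chain_connected e hk
  have he := chain_edges e hk
  have hn := card_chain e
  have : Nontrivial V := Finite.one_lt_card_iff_nontrivial.1 (by omega)
  have h2 : {f | (chainRotation e).size f = 2} = ∅ := by
    rw [Set.eq_empty_iff_forall_notMem]
    exact fun f => RotationSystem.size_two_of_connected hc (by omega) f
  have hiso : {v : V | ∀ w, ¬ (chainGraph e).Adj v w} = ∅ := by
    rw [Set.eq_empty_iff_forall_notMem]
    intro v hv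
    obtain ⟨w, hw⟩ := hc.preconnected.exists_adj_of_nontrivial v
    exact hv w hw
  have h4 := (chainRotation e).four_mul_card_face_le.2.2 (chain_size_le e)
  have h3 := (chainRotation e).three_mul_triFaces
  rw [ncard_chain_tri] at h3
  rw [h2, Set.ncard_empty] at h4
  rw [RotationSystem.IsPlane, RotationSystem.card_connectedComponent_of_connected hc, hiso,
    Set.ncard_empty]
  omega

end Chain

end PlanarTuran

/-! ### The bound, its equality cases and the extremal graphs. -/

theorem theorem2p3 (n : ℕ) (hn : 13 ≤ n) :
    ((PlanarTuran.planarTuranNumber n (PlanarTuran.friendshipGraph 3) : ℚ) ≤ 67 * (n : ℚ) / 24 - 4) ∧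
    ((PlanarTuran.planarTuranNumber n (PlanarTuran.friendshipGraph 3) : ℚ) = 67 * (n : ℚ) / 24 - 4
      ↔ 24 ∣ n) ∧
    (∀ (G : SimpleGraph (Fin n)) (M : PlanarTuran.RotationSystem G), M.IsPlane →
      (PlanarTuran.friendshipGraph 3).Free G →
      ((G.edgeSet.ncard : ℚ) = 67 * (n : ℚ) / 24 - 4 ↔ M.IsIcosahedralPattern)) := by
  classical
  have hcard : 13 ≤ Nat.card (Fin n) := by rwa [Nat.card_fin]
  have cast_le : ∀ m : ℕ, (m : ℚ) ≤ 67 * (n : ℚ) / 24 - 4 ↔ 24 * m + 96 ≤ 67 * n := by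
    intro m
    rw [← Nat.cast_le (α := ℚ)]
    push_cast
    constructor <;> intro h <;> linarith
  have cast_eq : ∀ m : ℕ, (m : ℚ) = 67 * (n : ℚ) / 24 - 4 ↔ 24 * m + 96 = 67 * n := by
    intro m
    rw [← Nat.cast_inj (R := ℚ)]
    push_cast
    constructor <;> intro h <;> linarith
  rw [cast_le, cast_eq]
  have hle : 24 * PlanarTuran.planarTuranNumber n (PlanarTuran.friendshipGraph 3) + 96 ≤ 67 * n := by
    have : PlanarTuran.planarTuranNumber n (PlanarTuran.friendshipGraph 3) ≤ (67 * n - 96) / 24 := by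
      refine Finset.sup_le fun G hG => ?_
      obtain ⟨⟨M, hM⟩, hfree⟩ := (Finset.mem_filter.1 hG).2
      have := (PlanarTuran.RotationSystem.edge_bound hM hfree hcard).1
      rw [Nat.card_fin] at this
      omega
    omega
  -- Equality reads 24m + 96 = 67n, and 67 is coprime to 24.
  refine ⟨hle, ⟨fun h => by omega, ?_⟩, fun G M hM hG => ?_⟩
  · rintro ⟨k, rfl⟩
    have hk : 0 < k := by omega
    let e : Fin (24 * k) ≃ Fin k × PlanarTuran.LinkVertex := Fintype.equivOfCardEq (by
      rw [Fintype.card_fin, Fintype.card_prod, Fintype.card_fin,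
        show Fintype.card PlanarTuran.LinkVertex = 24 from rfl, mul_comm])
    have h1 : (PlanarTuran.chainGraph e).edgeSet.ncard ≤ PlanarTuran.planarTuranNumber (24 * k) (PlanarTuran.friendshipGraph 3) :=
      Finset.le_sup (f := fun G : SimpleGraph (Fin (24 * k)) => G.edgeSet.ncard)
        (Finset.mem_filter.2 ⟨Finset.mem_univ _, ⟨_, PlanarTuran.chain_isPlane e hk⟩, PlanarTuran.chain_free e⟩)
    have h2 := PlanarTuran.chain_edges e hk
    omega
  · rw [cast_eq, ← PlanarTuran.RotationSystem.edge_count_iff hM hG hcard, Nat.card_fin]
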